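/- Let $\alpha\in(0,1)$ and $\rho\in(0,1/\alpha]$, and write $\Gamma(\rho;y)=\int_y^{\infty}e^{-w}w^{\rho-1}\,dw$. The Fox function $H^{m,n}_{p,q}$ is defined by the Mellin–Barnes integral $$H^{m,n}_{p,q}\!\left[z\,\middle|\,\begin{matrix}(a_1,A_1)\ \dots\ (a_p,A_p)\\(b_1,B_1)\ \dots\ (b_q,B_q)\end{matrix}\right]=\frac1{2\pi i}\int_{c-i\infty}^{c+i\infty}\frac{\prod_{j=1}^m\Gamma(b_j+B_js)\prod_{j=1}^n\Gamma(1-a_j-A_js)}{\prod_{j=m+1}^q\Gamma(1-b_j-B_js)\prod_{j=n+1}^p\Gamma(a_j+A_js)}\,z^{-s}\,ds,$$ where the line $\operatorname{Re}s=c$ separates the poles of $\Gamma(b_j+B_js)$, $j\le m$ (on the left), from those of $\Gamma(1-a_j-A_js)$, $j\le n$ (on the right). For every $t>0$ there is exactly one probability measure on $[0,\infty)$ with Laplace transform $\eta\mapsto\Gamma(\rho;\eta^{\alpha}t)/\Gamma(\rho)$, $\eta>0$. It is absolutely continuous, with a measurable non-negative density $h_\alpha^\rho(\cdot,t)$ that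 vanishes on $(-\infty,0]$ and satisfies $$h_\alpha^\rho(x,t)=\frac{\alpha}{x\,\Gamma(\rho)}\,H^{0,1}_{1,1}\!\left[\frac{x^\alpha}{t}\,\middle|\,\begin{matrix}(1-\rho,1)\\(0,\alpha)\end{matrix}\right],\qquad x>0,$$ where the Mellin–Barnes integral converges absolutely along every separating line, with a value that does not depend on the line. In particular, let $\mathcal X_{\alpha,\rho}=(\mathcal X_{\alpha,\rho}(t))_{t\ge0}$ be a non-negative process with $\mathcal X_{\alpha,\rho}(0)=0$ almost surely such that, for all $n$, all $0=t_0<t_1<\dots<t_n$ and all $\eta_1,\dots,\eta_n\ge0$, $$\mathbb E\,e^{-\sum_{k=1}^n\eta_k\mathcal X_{\alpha,\rho}(t_k)}=\frac1{\Gamma(\rho)}\,\Gamma\Big(\rho;\sum_{k=1}^n\Big(\sum_{i=k}^n\eta_i\Big)^{\alpha}(t_k-t_{k-1})\Big).$$ Then for every $t>0$ the law of $\mathcal X_{\alpha,\rho}(t)$ has the density $h_\alpha^\rho(\cdot,t)$. For $\rho=1$ this is the $\alpha$-stable law: $\int_0^\infty e^{-\eta x}h_\alpha^1(x,t)\,dx=e^{-\eta^\alpha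 t}$ for all $\eta,t>0$, and $$h_\alpha^1(x,t)=\frac1{\alpha\,t^{1/\alpha}}\,H^{1,0}_{1,1}\!\left[\frac{t^{1/\alpha}}{x}\,\middle|\,\begin{matrix}(1,1)\\(\tfrac1\alpha,\tfrac1\alpha)\end{matrix}\right],\qquad x,t>0,$$ where this Mellin–Barnes integral also converges absolutely along every separating line, with a value that does not depend on the line. -/

import Mathlib

open MeasureTheory

noncomputable section

/-- The upper incomplete gamma function `Γ(ρ; x) = ∫_x^∞ e^{-w} w^{ρ-1} dw`. -/
def upperIncompleteGamma (ρ x : ℝ) : ℝ :=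
  ∫ w in Set.Ioi x, Real.exp (-w) * w ^ (ρ - 1)

/-- The integrand of the Mellin–Barnes integral that defines the Fox function
`H^{m,n}_{p,q}[z | (a₁,A₁) … (a_p,A_p); (b₁,B₁) … (b_q,B_q)]`, with `A_j, B_j > 0`. The indices here start at `0`, so
"`j = 1, …, m`" reads `j < m`, and "`j = m+1, …, q`" reads `m ≤ j`. In the denominator
Mathlib's conventions `Γ(-k) = 0` and `x / 0 = 0` give the usual zeros of `1 / Γ`. -/
def foxHIntegrand (m n : ℕ) {p q : ℕ} (a A : Fin p → ℝ) (b B : Fin q → ℝ) (z s : ℂ) : ℂ :=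
  ((∏ j : Fin q with j.val < m, Complex.Gamma (b j + B j * s)) *
      (∏ j : Fin p with j.val < n, Complex.Gamma (1 - a j - A j * s)) * z ^ (-s)) /
    ((∏ j : Fin q with m ≤ j.val, Complex.Gamma (1 - b j - B j * s)) *
      (∏ j : Fin p with n ≤ j.val, Complex.Gamma (a j + A j * s)))

/-- The vertical line `Re s = c` separates the poles of the factors `Γ(b_j + B_j s)`, `j ≤ m`
(these poles are the points `-(b_j + k) / B_j`, on the left), from the poles of the factors
`Γ(1 - a_l - A_l s)`, `l ≤ n` (the points `(1 - a_l + k) / A_l`, on the right). -/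
def FoxHSeparates (m n : ℕ) {p q : ℕ} (a A : Fin p → ℝ) (b B : Fin q → ℝ) (c : ℝ) : Prop :=
  (∀ j : Fin q, j.val < m → ∀ k : ℕ, -(b j + k) / B j < c) ∧
    ∀ l : Fin p, l.val < n → ∀ k : ℕ, c < (1 - a l + k) / A l

/-- The Mellin–Barnes integral `(1 / 2πi) ∫ … ds` along the line `s = c + i y`, upwards. -/
def foxHLineIntegral (m n : ℕ) {p q : ℕ} (a A : Fin p → ℝ) (b B : Fin q → ℝ) (c : ℝ) (z : ℂ) :
    ℂ :=
  1 / (2 * Real.pi * Complex.I) *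
    ∫ y : ℝ, foxHIntegrand m n a A b B z (c + y * Complex.I) * Complex.I

open Classical in
/-- The Fox function `H^{m,n}_{p,q}`, for parameters that admit a separating vertical line (else it
is `0`): the Mellin–Barnes integral along such a line, from `c - i∞` to `c + i∞`. -/
def foxH (m n : ℕ) {p q : ℕ} (a A : Fin p → ℝ) (b B : Fin q → ℝ) (z : ℂ) : ℂ :=
  if h : ∃ c : ℝ, FoxHSeparates m n a A b B c then foxHLineIntegral m n a A b B h.choose z else 0

/-- The Fox function is well defined at `z`: there is a separating line, and along every separating
line the Mellin–Barnes integral converges absolutely, with one and the same value. -/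
def FoxHExists (m n : ℕ) {p q : ℕ} (a A : Fin p → ℝ) (b B : Fin q → ℝ) (z : ℂ) : Prop :=
  (∃ c : ℝ, FoxHSeparates m n a A b B c) ∧
    ∀ c : ℝ, FoxHSeparates m n a A b B c →
      Integrable (fun y : ℝ => foxHIntegrand m n a A b B z (c + y * Complex.I)) ∧
        foxHLineIntegral m n a A b B c z = foxH m n a A b B z

/-- `μ` is the one-dimensional law of the generalized stable process at time `t`: a probability
measure on `[0, ∞)` with Laplace transform `Γ(ρ; η^α t) / Γ(ρ)`. -/
structure IsGenStableLaw (α ρ t : ℝ) (μ : Measure ℝ) : Prop where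
  isProbabilityMeasure : IsProbabilityMeasure μ
  nonneg : ∀ᵐ x ∂μ, 0 ≤ x
  laplace : ∀ η : ℝ, 0 < η →
    ∫ x, Real.exp (-(η * x)) ∂μ = upperIncompleteGamma ρ (η ^ α * t) / Real.Gamma ρ

/-- `X` is a generalized stable process: non-negative, `X(0) = 0` almost surely, and for all
`0 = t₀ < t₁ < … < t_n` and `η₁, …, η_n ≥ 0`,
`E exp(-∑ₖ ηₖ X(tₖ)) = Γ(ρ; ∑ₖ (ηₖ + … + η_n)^α (tₖ - tₖ₋₁)) / Γ(ρ)`. -/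
structure IsGenStableProcess {Ω : Type*} [MeasurableSpace Ω] (P : Measure Ω) (α ρ : ℝ)
    (X : NNReal → Ω → ℝ) : Prop where
  isProbabilityMeasure : IsProbabilityMeasure P
  aemeasurable : ∀ t, AEMeasurable (X t) P
  nonneg : ∀ t, ∀ᵐ ω ∂P, 0 ≤ X t ω
  zero : ∀ᵐ ω ∂P, X 0 ω = 0
  laplace : ∀ (n : ℕ) (τ : ℕ → NNReal) (η : ℕ → ℝ), τ 0 = 0 → (∀ k < n, τ k < τ (k + 1)) →
    (∀ k ∈ Finset.Icc 1 n, 0 ≤ η k) →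
    ∫ ω, Real.exp (-∑ k ∈ Finset.Icc 1 n, η k * X (τ k) ω) ∂P =
      upperIncompleteGamma ρ
        (∑ k ∈ Finset.Icc 1 n,
          (∑ i ∈ Finset.Icc k n, η i) ^ α * ((τ k : ℝ) - (τ (k - 1) : ℝ))) / Real.Gamma ρ

end

/-! Write κ(x) for the Mellin–Barnes integral at x^α/t, so that the density is α κ(x) / (x Γ(ρ)). By
Fubini, Euler's integral in x cancels the denominator Γ(1 - αs), and Mellin inversion of the
remaining Γ(ρ - s) gives, with w = η^α t, the Laplace transform η⁻¹ w^ρ e^{-w} of κ. This is -1/α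
times the η-derivative of Γ(ρ; w). Since e^{-ηx}/x is the integral of e^{-ux} over u > η, dividing κ
by x integrates the transform back to Γ(ρ; w); at η = 0 this yields total mass 1
(`lintegral_exp_mul_genStableDensity`, `lintegral_eq_upperIncompleteGamma`).

Convergence rests on |Γ| decaying like e^{-π|y|/2} on vertical lines, up to an arbitrarily small
loss in the rate; the denominator gives back only the fraction α of that rate.

Positivity of κ comes from its transform t^ρ η^{αρ-1} e^{-tη^α}, a product of completely monotone
functions because αρ ≤ 1 and α < 1. Sampling at positive integers suffices: the samples are
Hausdorff moments in the variable e^{-x}, and Bernstein polynomials turn the signs of their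
differences into the sign of a continuous function (`nonneg_of_completelyMonotoneSeq_laplace`).

The same criterion replaces contour shifting. Kernels from two lines have equal transforms, their
difference has the zero moment sequence, and so it is non-negative with either sign.

Uniqueness of the law is Stone–Weierstrass for polynomials in e^{-x}. The case ρ = 1 follows from s
↦ -(1 + s)/α and Γ(z + 1) = zΓ(z). -/

/-! ### Exponential bounds for Γ and 1/Γ on vertical lines, without Stirling's formula. -/

section GammaBounds

open Complex

/-- The modulus of `Γ` on the critical line `Re s = 1/2`. -/
theorem Complex.norm_Gamma_half_sq (y : ℝ) :
    ‖Gamma (1 / 2 + y * I)‖ ^ 2 = Real.pi / Real.cosh (Real.pi * y) := by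
  have h1 := Complex.Gamma_mul_Gamma_one_sub (1 / 2 + y * I)
  have hconj : (1 : ℂ) - (1 / 2 + y * I) = (starRingEnd ℂ) (1 / 2 + y * I) := by
    apply Complex.ext <;> simp
    norm_num
  rw [hconj, Complex.Gamma_conj, Complex.mul_conj] at h1
  have hsin : Complex.sin (Real.pi * (1 / 2 + y * I)) = (Real.cosh (Real.pi * y) : ℂ) := by
    have : (Real.pi : ℂ) * (1 / 2 + y * I) = (Real.pi * y : ℂ) * I + Real.pi / 2 := by ring
    rw [this, Complex.sin_add_pi_div_two, Complex.cos_mul_I]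
    push_cast
    rfl
  rw [hsin, Complex.normSq_eq_norm_sq] at h1
  exact_mod_cast h1

theorem Real.cosh_le_exp_abs (x : ℝ) : Real.cosh x ≤ Real.exp |x| := by
  rw [← Real.cosh_abs, Real.cosh_eq]
  have : Real.exp (-|x|) ≤ Real.exp |x| := Real.exp_le_exp.2 (by linarith [abs_nonneg x])
  linarith

theorem Real.exp_abs_le_two_mul_cosh (x : ℝ) : Real.exp |x| ≤ 2 * Real.cosh x := by
  rw [← Real.cosh_abs, Real.cosh_eq]
  have := Real.exp_pos (-|x|)
  linarith

theorem Complex.norm_betaIntegral_le (u v : ℂ) :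
    ‖betaIntegral u v‖ ≤ ∫ x in (0 : ℝ)..1, x ^ (u.re - 1) * (1 - x) ^ (v.re - 1) := by
  unfold betaIntegral
  refine (intervalIntegral.norm_integral_le_integral_norm zero_le_one).trans (le_of_eq ?_)
  rw [intervalIntegral.integral_of_le zero_le_one, intervalIntegral.integral_of_le zero_le_one,
    integral_Ioc_eq_integral_Ioo, integral_Ioc_eq_integral_Ioo]
  refine setIntegral_congr_fun measurableSet_Ioo fun x hx => ?_
  have h1 : (1 : ℂ) - x = ((1 - x : ℝ) : ℂ) := by push_cast; rfl
  simp only [norm_mul, h1]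
  rw [Complex.norm_cpow_eq_rpow_re_of_pos hx.1,
    Complex.norm_cpow_eq_rpow_re_of_pos (by linarith [hx.2])]
  simp

/-- Exponential decay of `Γ` on a vertical line, as a property of the abscissa. -/
def GammaDecay (c : ℝ) : Prop :=
  ∀ ε > 0, ∃ C > 0, ∀ y : ℝ, ‖Gamma (c + y * I)‖ ≤ C * Real.exp (-(Real.pi / 2 - ε) * |y|)

/-- The matching growth of `1 / Γ` on a vertical line. -/
def InvGammaGrowth (c : ℝ) : Prop :=
  ∀ ε > 0, ∃ C > 0, ∀ y : ℝ, ‖(Gamma (c + y * I))⁻¹‖ ≤ C * Real.exp ((Real.pi / 2 + ε) * |y|)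

/-- The linear factor from Γ(s + 1) = sΓ(s) is absorbed into an exponential of arbitrarily small
rate; this is why the bounds carry an ε. -/
theorem norm_add_mul_I_le_mul_exp {c ε : ℝ} (hc : 0 < c) (hε : 0 < ε) (y : ℝ) :
    ‖(c + y * I : ℂ)‖ ≤ (c + 1 / ε) * Real.exp (ε * |y|) := by
  have h1 : ‖(c + y * I : ℂ)‖ ≤ c + |y| := by
    refine (norm_add_le _ _).trans ?_
    simp [abs_of_pos hc]
  have h2 : ε * |y| ≤ Real.exp (ε * |y|) := by
    linarith [Real.add_one_le_exp (ε * |y|)]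
  have h3 : 1 ≤ Real.exp (ε * |y|) := Real.one_le_exp (by positivity)
  have h4 : |y| ≤ 1 / ε * Real.exp (ε * |y|) := by
    rw [one_div, inv_mul_eq_div, le_div_iff₀ hε]
    linarith
  nlinarith

theorem gammaDecay_half : GammaDecay (1 / 2) := by
  intro ε hε
  -- The constant comes from π / cosh(πy) ≤ 2π e^{-π|y|}.
  refine ⟨Real.sqrt (2 * Real.pi), by positivity, fun y => ?_⟩
  have hsq := Complex.norm_Gamma_half_sq y
  push_cast
  refine (sq_le_sq₀ (norm_nonneg _) (by positivity)).1 ?_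
  rw [hsq, mul_pow, Real.sq_sqrt (by positivity), ← Real.exp_nat_mul]
  have h1 := Real.exp_abs_le_two_mul_cosh (Real.pi * y)
  rw [abs_mul, abs_of_pos Real.pi_pos] at h1
  rw [div_le_iff₀ (Real.cosh_pos _)]
  have h2 : (1 : ℝ) ≤ Real.exp ((2 : ℕ) * (-(Real.pi / 2 - ε) * |y|)) * Real.exp (Real.pi * |y|) := by
    rw [← Real.exp_add]
    apply Real.one_le_exp
    push_cast
    have : 0 ≤ ε * |y| := by positivity
    linarith
  have h3 := Real.exp_pos ((2 : ℕ) * (-(Real.pi / 2 - ε) * |y|))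
  have h4 : 1 ≤ Real.exp ((2 : ℕ) * (-(Real.pi / 2 - ε) * |y|)) * (2 * Real.cosh (Real.pi * y)) :=
    h2.trans (by gcongr)
  nlinarith [Real.pi_pos]

theorem invGammaGrowth_half : InvGammaGrowth (1 / 2) := by
  intro ε hε
  refine ⟨1, one_pos, fun y => ?_⟩
  have hsq := Complex.norm_Gamma_half_sq y
  push_cast
  refine (sq_le_sq₀ (norm_nonneg _) (by positivity)).1 ?_
  rw [norm_inv, inv_pow, hsq, inv_div, one_mul, ← Real.exp_nat_mul, div_le_iff₀ Real.pi_pos]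
  have h1 := Real.cosh_le_exp_abs (Real.pi * y)
  rw [abs_mul, abs_of_pos Real.pi_pos] at h1
  have h2 : Real.exp (Real.pi * |y|) ≤ Real.exp ((2 : ℕ) * ((Real.pi / 2 + ε) * |y|)) := by
    apply Real.exp_le_exp.2
    push_cast
    have : 0 ≤ ε * |y| := by positivity
    linarith
  have h3 := Real.exp_pos ((2 : ℕ) * ((Real.pi / 2 + ε) * |y|))
  nlinarith [Real.pi_gt_three]

theorem GammaDecay.add_one {c : ℝ} (hc : 0 < c) (h : GammaDecay c) : GammaDecay (c + 1) := by
  intro ε hε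
  obtain ⟨C, hC, hb⟩ := h (ε / 2) (by positivity)
  refine ⟨(c + 1 / (ε / 2)) * C, by positivity, fun y => ?_⟩
  have hne : (c + y * I : ℂ) ≠ 0 := fun h0 => by
    have := congrArg Complex.re h0
    simp at this
    exact hc.ne' this
  have hrw : ((c + 1 : ℝ) + y * I : ℂ) = (c + y * I) + 1 := by push_cast; ring
  rw [hrw, Complex.Gamma_add_one _ hne, norm_mul]
  calc _ ≤ ((c + 1 / (ε / 2)) * Real.exp (ε / 2 * |y|)) *
        (C * Real.exp (-(Real.pi / 2 - ε / 2) * |y|)) := by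
        gcongr
        · exact norm_add_mul_I_le_mul_exp hc (by positivity) y
        · exact hb y
    _ = _ := by
        rw [mul_mul_mul_comm, ← Real.exp_add]
        congr 2
        ring

theorem InvGammaGrowth.of_add_one {c : ℝ} (hc : 0 < c) (h : InvGammaGrowth (c + 1)) :
    InvGammaGrowth c := by
  intro ε hε
  obtain ⟨C, hC, hb⟩ := h (ε / 2) (by positivity)
  refine ⟨(c + 1 / (ε / 2)) * C, by positivity, fun y => ?_⟩
  have hne : (c + y * I : ℂ) ≠ 0 := fun h0 => by
    have := congrArg Complex.re h0
    simp at this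
    exact hc.ne' this
  have hrw : ((c + 1 : ℝ) + y * I : ℂ) = (c + y * I) + 1 := by push_cast; ring
  have hinv : (Gamma (c + y * I))⁻¹ = (c + y * I) * (Gamma ((c + 1 : ℝ) + y * I))⁻¹ := by
    rw [hrw, Complex.Gamma_add_one _ hne, mul_inv, mul_inv_cancel_left₀ hne]
  rw [hinv, norm_mul]
  calc _ ≤ ((c + 1 / (ε / 2)) * Real.exp (ε / 2 * |y|)) *
        (C * Real.exp ((Real.pi / 2 + ε / 2) * |y|)) := by
        gcongr
        · exact norm_add_mul_I_le_mul_exp hc (by positivity) y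
        · exact hb y
    _ = _ := by
        rw [mul_mul_mul_comm, ← Real.exp_add]
        congr 2
        ring

/-- Γ(s)Γ(w) = B(s, w)Γ(s + w), and |B(s, w)| is at most the Beta integral at Re s, uniformly in y.
This carries decay of Γ to smaller abscissas and growth of 1/Γ to larger ones. -/
theorem norm_Gamma_mul_le_of_re_shift {c w : ℝ} (hc : 0 < c) (hw : 0 < w) :
    ∃ B ≥ 0, ∀ y : ℝ, ‖Gamma (c + y * I)‖ ≤ B * ‖Gamma ((c + w : ℝ) + y * I)‖ := by
  refine ⟨(∫ x in (0 : ℝ)..1, x ^ (c - 1) * (1 - x) ^ (w - 1)) * (Real.Gamma w)⁻¹, ?_, fun y => ?_⟩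
  · refine mul_nonneg (intervalIntegral.integral_nonneg zero_le_one fun x hx => ?_)
      (inv_nonneg.2 (Real.Gamma_pos_of_pos hw).le)
    exact mul_nonneg (Real.rpow_nonneg hx.1 _) (Real.rpow_nonneg (by linarith [hx.2]) _)
  · have h1 := Complex.Gamma_mul_Gamma_eq_betaIntegral (s := c + y * I) (t := (w : ℂ))
      (by simpa using hc) (by simpa using hw)
    have h2 := Complex.norm_betaIntegral_le (c + y * I) w
    have h3 := congrArg norm h1
    have hrw : (c + y * I + w : ℂ) = (c + w : ℝ) + y * I := by push_cast; ring
    rw [norm_mul, norm_mul, hrw, Complex.Gamma_ofReal, Complex.norm_real, Real.norm_eq_abs,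
      abs_of_pos (Real.Gamma_pos_of_pos hw)] at h3
    simp only [Complex.add_re, Complex.ofReal_re, Complex.mul_re, Complex.I_re, Complex.ofReal_im,
      mul_zero, Complex.I_im, zero_mul, sub_zero, add_zero] at h2
    have hG := Real.Gamma_pos_of_pos hw
    rw [mul_right_comm, ← div_eq_mul_inv, le_div_iff₀ hG, h3, mul_comm]
    gcongr

theorem gammaDecay {c : ℝ} (hc : 0 < c) : GammaDecay c := by
  have hn : ∀ n : ℕ, GammaDecay (1 / 2 + n) := by
    intro n
    induction n with
    | zero => simpa using gammaDecay_half
    | succ n ih =>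
      have := ih.add_one (by positivity)
      rwa [add_assoc, ← Nat.cast_succ] at this
  -- The recurrence reaches only the abscissas 1/2 + n; one above c is compared downwards with c.
  obtain ⟨n, hn'⟩ := exists_nat_gt c
  obtain ⟨B, hB, hb⟩ := norm_Gamma_mul_le_of_re_shift hc (w := 1 / 2 + n - c) (by linarith)
  intro ε hε
  obtain ⟨C, hC, hCb⟩ := hn n ε hε
  refine ⟨(B + 1) * C, by positivity, fun y => ?_⟩
  have h1 := hb y
  rw [add_sub_cancel] at h1
  calc _ ≤ _ := h1
    _ ≤ (B + 1) * (C * Real.exp (-(Real.pi / 2 - ε) * |y|)) := by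
      gcongr
      · linarith
      · exact hCb y
    _ = _ := by ring

theorem invGammaGrowth_of_half_lt {c : ℝ} (hc : 1 / 2 < c) : InvGammaGrowth c := by
  intro ε hε
  obtain ⟨C, hC, hCb⟩ := invGammaGrowth_half ε hε
  obtain ⟨B, hB, hb⟩ := norm_Gamma_mul_le_of_re_shift one_half_pos (w := c - 1 / 2) (by linarith)
  refine ⟨(B + 1) * C, by positivity, fun y => ?_⟩
  have h1 := hb y
  rw [add_sub_cancel] at h1
  have hne : ∀ d : ℝ, 0 < d → 0 < ‖Gamma (d + y * I)‖ := fun d hd =>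
    norm_pos_iff.2 (Complex.Gamma_ne_zero_of_re_pos (by simpa using hd))
  have hp := hne (1 / 2) one_half_pos
  have hq := hne c (by linarith)
  calc ‖(Gamma (c + y * I))⁻¹‖ ≤ B * ‖(Gamma ((1 / 2 : ℝ) + y * I))⁻¹‖ := by
        rw [norm_inv, norm_inv, ← div_eq_mul_inv, le_div_iff₀ hp, inv_mul_le_iff₀ hq, mul_comm _ B]
        exact h1
    _ ≤ (B + 1) * (C * Real.exp ((Real.pi / 2 + ε) * |y|)) := by
      gcongr
      · linarith
      · exact hCb y
    _ = _ := by ring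

theorem invGammaGrowth {c : ℝ} (hc : 0 < c) : InvGammaGrowth c :=
  (invGammaGrowth_of_half_lt (by linarith)).of_add_one hc

theorem integrable_exp_neg_mul_abs {a : ℝ} (ha : 0 < a) :
    Integrable fun y : ℝ => Real.exp (-a * |y|) := by
  rw [← integrableOn_univ, ← Set.Iic_union_Ioi (a := (0 : ℝ))]
  refine IntegrableOn.union ?_ ?_
  · refine (integrableOn_congr_fun (fun y hy => ?_) measurableSet_Iic).1 (integrableOn_exp_mul_Iic ha 0)
    rw [abs_of_nonpos hy]
    ring_nf
  · refine (integrableOn_congr_fun (fun y hy => ?_) measurableSet_Ioi).1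
      (integrableOn_exp_mul_Ioi (neg_lt_zero.2 ha) 0)
    rw [abs_of_pos hy]

theorem continuous_Gamma_line {c : ℝ} (hc : 0 < c) (b : ℝ) :
    Continuous fun y : ℝ => Gamma (c + (b * y : ℝ) * I) := by
  refine continuous_iff_continuousAt.2 fun y => ?_
  refine ContinuousAt.comp (g := Gamma) ?_ (by fun_prop)
  refine (Complex.differentiableAt_Gamma _ fun m hm => ?_).continuousAt
  have := congrArg Complex.re hm
  simp at this
  have h0 : (0 : ℝ) ≤ m := m.cast_nonneg
  linarith

theorem integrable_Gamma_line {c : ℝ} (hc : 0 < c) :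
    Integrable fun y : ℝ => Gamma (c + y * I) := by
  obtain ⟨C, hC, hb⟩ := gammaDecay hc 1 one_pos
  refine Integrable.mono' ((integrable_exp_neg_mul_abs (a := Real.pi / 2 - 1)
    (by linarith [Real.pi_gt_three])).const_mul C) ?_ (.of_forall hb)
  simpa using (continuous_Gamma_line hc 1).aestronglyMeasurable

end GammaBounds

/-! ### Completely monotone sequences and their closure properties. -/

section CompletelyMonotoneSequences

open Set Filter Topology

/-- The difference `a n - a (n + 1)` of a sequence. -/
def seqDiff (a : ℕ → ℝ) (n : ℕ) : ℝ := a n - a (n + 1)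

/-- Completely monotone sequences: all iterated differences `a n - a (n + 1)` are non-negative. -/
def CompletelyMonotoneSeq (a : ℕ → ℝ) : Prop := ∀ k n, 0 ≤ (seqDiff^[k] a) n

namespace CompletelyMonotoneSeq

variable {a b : ℕ → ℝ}

theorem nonneg (h : CompletelyMonotoneSeq a) (n : ℕ) : 0 ≤ a n := h 0 n

theorem seqDiff (h : CompletelyMonotoneSeq a) : CompletelyMonotoneSeq (seqDiff a) := fun k n => by
  simpa using h (k + 1) n

theorem shift (h : CompletelyMonotoneSeq a) : CompletelyMonotoneSeq fun n => a (n + 1) := by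
  have key : ∀ (k : ℕ) (a : ℕ → ℝ) (n : ℕ),
      (_root_.seqDiff^[k] fun n => a (n + 1)) n = (_root_.seqDiff^[k] a) (n + 1) := by
    intro k
    induction k with
    | zero => intro a n; rfl
    | succ k ih =>
      intro a n
      rw [Function.iterate_succ_apply, Function.iterate_succ_apply, ← ih]
      rfl
  intro k n
  rw [key]
  exact h k (n + 1)

theorem add (ha : CompletelyMonotoneSeq a) (hb : CompletelyMonotoneSeq b) :
    CompletelyMonotoneSeq (a + b) := by
  intro k
  induction k generalizing a b with
  | zero => exact fun n => add_nonneg (ha.nonneg n) (hb.nonneg n)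
  | succ k ih =>
    intro n
    have h := ih ha.seqDiff hb.seqDiff n
    rw [Function.iterate_succ_apply]
    convert h using 2
    funext m
    simp only [_root_.seqDiff, Pi.add_apply]
    ring

/-- The discrete Leibniz rule. -/
theorem mul (ha : CompletelyMonotoneSeq a) (hb : CompletelyMonotoneSeq b) :
    CompletelyMonotoneSeq (a * b) := by
  have key : ∀ (k : ℕ) (a b : ℕ → ℝ), CompletelyMonotoneSeq a → CompletelyMonotoneSeq b →
      ∀ n, 0 ≤ (_root_.seqDiff^[k] (a * b)) n := by
    intro k
    induction k with
    | zero => exact fun a b ha hb n => mul_nonneg (ha.nonneg n) (hb.nonneg n)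
    | succ k ih =>
      intro a b ha hb n
      have hlin : ∀ (k : ℕ) (f g : ℕ → ℝ),
          _root_.seqDiff^[k] (f + g) = _root_.seqDiff^[k] f + _root_.seqDiff^[k] g := by
        intro k
        induction k with
        | zero => intro f g; rfl
        | succ k ih =>
          intro f g
          rw [Function.iterate_succ_apply, Function.iterate_succ_apply,
            Function.iterate_succ_apply, ← ih]
          congr 1
          funext m
          simp only [_root_.seqDiff, Pi.add_apply]
          ring
      have hrw : _root_.seqDiff (a * b) =
          _root_.seqDiff a * b + (fun n => a (n + 1)) * _root_.seqDiff b := by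
        funext m
        simp only [_root_.seqDiff, Pi.mul_apply, Pi.add_apply]
        ring
      rw [Function.iterate_succ_apply, hrw, hlin]
      exact add_nonneg (ih _ _ ha.seqDiff hb n) (ih _ _ ha.shift hb.seqDiff n)
  exact fun k n => key k a b ha hb n

theorem const {c : ℝ} (hc : 0 ≤ c) : CompletelyMonotoneSeq fun _ => c := by
  have hz : ∀ k, _root_.seqDiff^[k] (fun _ => (0 : ℝ)) = fun _ => 0 := by
    intro k
    induction k with
    | zero => rfl
    | succ k ih =>
      rw [Function.iterate_succ_apply]
      have : _root_.seqDiff (fun _ => (0 : ℝ)) = fun _ => 0 := by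
        funext m
        simp [_root_.seqDiff]
      rw [this, ih]
  intro k n
  cases k with
  | zero => exact hc
  | succ k =>
    have : _root_.seqDiff (fun _ => c) = fun _ => 0 := by
      funext m
      simp [_root_.seqDiff]
    rw [Function.iterate_succ_apply, this, hz]

theorem const_mul {c : ℝ} (hc : 0 ≤ c) (ha : CompletelyMonotoneSeq a) :
    CompletelyMonotoneSeq fun n => c * a n :=
  (const hc).mul ha

theorem pow (ha : CompletelyMonotoneSeq a) (k : ℕ) : CompletelyMonotoneSeq fun n => a n ^ k := by
  induction k with
  | zero => simpa using const zero_le_one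
  | succ k ih =>
    have := ih.mul ha
    convert this using 2
    exact pow_succ _ _

theorem sum {f : ℕ → ℕ → ℝ} (h : ∀ i, CompletelyMonotoneSeq (f i)) (N : ℕ) :
    CompletelyMonotoneSeq fun n => ∑ i ∈ Finset.range N, f i n := by
  induction N with
  | zero => simpa using const le_rfl
  | succ N ih =>
    have := ih.add (h N)
    convert this using 2
    rw [Finset.sum_range_succ]
    rfl

theorem of_tendsto {f : ℕ → ℕ → ℝ} (h : ∀ i, CompletelyMonotoneSeq (f i))
    (hlim : ∀ n, Tendsto (fun i => f i n) atTop (𝓝 (a n))) : CompletelyMonotoneSeq a := by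
  have key : ∀ (k : ℕ) (f : ℕ → ℕ → ℝ) (a : ℕ → ℝ),
      (∀ n, Tendsto (fun i => f i n) atTop (𝓝 (a n))) →
      ∀ n, Tendsto (fun i => (_root_.seqDiff^[k] (f i)) n) atTop
        (𝓝 ((_root_.seqDiff^[k] a) n)) := by
    intro k
    induction k with
    | zero => exact fun f a h => h
    | succ k ih =>
      intro f a h n
      simp only [Function.iterate_succ_apply]
      exact ih (fun i => _root_.seqDiff (f i)) _ (fun m => (h m).sub (h (m + 1))) n
  exact fun k n => ge_of_tendsto' (key k f a hlim n) fun i => h i k n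

/-- The partial sums of the exponential series are combinations of powers with non-negative
coefficients. -/
theorem exp (ha : CompletelyMonotoneSeq a) : CompletelyMonotoneSeq fun n => Real.exp (a n) := by
  refine of_tendsto (f := fun N n => ∑ i ∈ Finset.range N, ((i.factorial : ℝ))⁻¹ * a n ^ i)
    (fun N => sum (f := fun i n => ((i.factorial : ℝ))⁻¹ * a n ^ i)
      (fun i => (ha.pow i).const_mul (by positivity)) N) fun n => ?_
  have := (NormedSpace.expSeries_div_hasSum_exp (a n)).tendsto_sum_nat
  rw [← Real.exp_eq_exp_ℝ] at this
  simpa only [div_eq_inv_mul] using this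

theorem iterate_seqDiff_pow_mul (r c : ℝ) (k n : ℕ) :
    (_root_.seqDiff^[k] fun n => r ^ n * c) n = r ^ n * (1 - r) ^ k * c := by
  induction k generalizing n with
  | zero => simp
  | succ k ih =>
    rw [Function.iterate_succ_apply', _root_.seqDiff, ih, ih]
    ring

theorem geometric {r : ℝ} (h0 : 0 ≤ r) (h1 : r ≤ 1) : CompletelyMonotoneSeq fun n => r ^ n :=
  fun k n => by
    have := iterate_seqDiff_pow_mul r 1 k n
    simp only [mul_one] at this
    rw [this]
    exact mul_nonneg (pow_nonneg h0 _) (pow_nonneg (by linarith) _)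

theorem iterate_seqDiff_integral {X : Type*} [MeasurableSpace X] {μ : Measure X} (k : ℕ) :
    ∀ {f : ℕ → X → ℝ}, (∀ n, Integrable (f n) μ) → ∀ n,
      (_root_.seqDiff^[k] fun n => ∫ x, f n x ∂μ) n =
        ∫ x, (_root_.seqDiff^[k] fun n => f n x) n ∂μ := by
  induction k with
  | zero => exact fun _ _ => rfl
  | succ k ih =>
    intro f hf n
    have h := ih (f := fun n x => f n x - f (n + 1) x) (fun n => (hf n).sub (hf (n + 1))) n
    rw [Function.iterate_succ_apply]
    have h1 : (_root_.seqDiff fun n => ∫ x, f n x ∂μ) =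
        fun n => ∫ x, f n x - f (n + 1) x ∂μ := by
      funext m
      exact (integral_sub (hf m) (hf (m + 1))).symm
    rw [h1, h]
    rfl

theorem integral {X : Type*} [MeasurableSpace X] {μ : Measure X} {f : ℕ → X → ℝ}
    (hf : ∀ n, Integrable (f n) μ) (h : ∀ᵐ x ∂μ, CompletelyMonotoneSeq fun n => f n x) :
    CompletelyMonotoneSeq fun n => ∫ x, f n x ∂μ := fun k n => by
  rw [iterate_seqDiff_integral k hf n]
  exact integral_nonneg_of_ae (h.mono fun x hx => hx k n)

/-- Euler's integral writes this as a positive mixture over x of the geometric sequences of ratio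
e^{-x}. -/
theorem one_div_add_rpow {s b : ℝ} (hs : 0 ≤ s) (hb : 0 < b) :
    CompletelyMonotoneSeq fun n : ℕ => (1 / (s + (n + 1))) ^ b := by
  have hpos : ∀ n : ℕ, 0 < s + ((n : ℝ) + 1) := fun n => by positivity
  have hG := Real.Gamma_pos_of_pos hb
  have hrep : (fun n : ℕ => (1 / (s + ((n : ℝ) + 1))) ^ b) = fun n : ℕ => (Real.Gamma b)⁻¹ *
      ∫ x : ℝ in Ioi 0, x ^ (b - 1) * Real.exp (-((s + ((n : ℝ) + 1)) * x)) := by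
    funext n
    rw [Real.integral_rpow_mul_exp_neg_mul_Ioi hb (hpos n)]
    field_simp
  rw [hrep]
  refine const_mul (inv_nonneg.2 hG.le) (integral (fun n => ?_) ?_)
  -- A non-integrable function has integral 0 by convention, but this integral is known to be
  -- positive.
  · by_contra hn
    have h1 := Real.integral_rpow_mul_exp_neg_mul_Ioi hb (hpos n)
    rw [integral_undef hn] at h1
    have : 0 < (1 / (s + ((n : ℝ) + 1))) ^ b * Real.Gamma b :=
      mul_pos (Real.rpow_pos_of_pos (one_div_pos.2 (hpos n)) _) hG
    exact this.ne h1
  · filter_upwards [ae_restrict_mem measurableSet_Ioi] with x (hx : 0 < x)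
    have := (geometric (Real.exp_pos (-x)).le (Real.exp_le_one_iff.2 (by linarith))).const_mul
      (c := x ^ (b - 1) * Real.exp (-((s + 1) * x)))
      (mul_nonneg (Real.rpow_nonneg hx.le _) (Real.exp_pos _).le)
    convert this using 2 with n
    rw [mul_assoc, ← Real.exp_nat_mul, ← Real.exp_add]
    congr 2
    ring

/-- `η ↦ exp (-t η ^ p)` is completely monotone along the positive integers, as a limit of
multiples of exponentials of superpositions of the functions `η ↦ 1 / (s + η)`. -/
theorem exp_neg_mul_rpow {p t : ℝ} (hp : p ∈ Ioo (0 : ℝ) 1) (ht : 0 ≤ t) :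
    CompletelyMonotoneSeq fun n : ℕ => Real.exp (-(t * ((n : ℝ) + 1) ^ p)) := by
  set C : ℝ := (∫ s in Ioi 0, Real.rpowIntegrand₀₁ p s 1)⁻¹ with hC
  have hC0 : 0 ≤ C := inv_nonneg.2 (Real.integral_rpowIntegrand₀₁_one_pos hp).le
  have hsub : ∀ N : ℕ, Ioc (0 : ℝ) N ⊆ Ioi 0 := fun N x hx => hx.1
  have hU : (⋃ N : ℕ, Ioc (0 : ℝ) N) = Ioi 0 := by
    ext x
    simp only [mem_iUnion, mem_Ioc, mem_Ioi]
    exact ⟨fun ⟨N, h⟩ => h.1, fun h => ⟨⌈x⌉₊, h, Nat.le_ceil x⟩⟩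
  have hint : ∀ n : ℕ, IntegrableOn (fun s => Real.rpowIntegrand₀₁ p s ((n : ℝ) + 1)) (Ioi 0) :=
    fun n => Real.integrableOn_rpowIntegrand₀₁_Ioi hp (by positivity)
  have hpow : ∀ N : ℕ, IntegrableOn (fun s : ℝ => s ^ (p - 1)) (Ioc 0 (N : ℝ)) := fun N => by
    rw [← intervalIntegrable_iff_integrableOn_Ioc_of_le N.cast_nonneg]
    exact intervalIntegral.intervalIntegrable_rpow' (by linarith [hp.1])
  -- η^p is C times the integral of s^{p-1} - s^p/(s + η) over s > 0. The two terms are split only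
  -- after truncation to (0, N], as s^{p-1} is not integrable at infinity; the first then
  -- contributes a positive constant factor to the exponential.
  have heq : ∀ (n : ℕ) (s : ℝ), 0 < s → s ^ p * (1 / (s + ((n : ℝ) + 1))) =
      s ^ (p - 1) - Real.rpowIntegrand₀₁ p s ((n : ℝ) + 1) := fun n s hs => by
    rw [Real.rpowIntegrand₀₁_eq_sub hp.2.ne hs, one_div]
    ring
  have hint2 : ∀ N n : ℕ, IntegrableOn (fun s : ℝ => s ^ p * (1 / (s + ((n : ℝ) + 1))))
      (Ioc 0 (N : ℝ)) := fun N n =>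
    (((hpow N).sub ((hint n).mono_set (hsub N))).congr_fun
      (fun s hs => (heq n s hs.1).symm) measurableSet_Ioc)
  refine of_tendsto (f := fun N n => Real.exp (-(t * (C * ∫ s in Ioc 0 (N : ℝ), s ^ (p - 1)))) *
    Real.exp (t * C * ∫ s in Ioc 0 (N : ℝ), s ^ p * (1 / (s + ((n : ℝ) + 1)))))
    (fun N => const_mul (Real.exp_pos _).le (exp (const_mul (by positivity)
      (integral (hint2 N) ?_)))) fun n => ?_
  · filter_upwards [ae_restrict_mem measurableSet_Ioc] with s hs
    have := (one_div_add_rpow hs.1.le one_pos).const_mul (Real.rpow_nonneg hs.1.le p)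
    simpa only [Real.rpow_one] using this
  · have h1 := tendsto_setIntegral_of_monotone (μ := volume) (s := fun N : ℕ => Ioc (0 : ℝ) N)
      (f := fun s => Real.rpowIntegrand₀₁ p s ((n : ℝ) + 1)) (fun N => measurableSet_Ioc)
      (fun N M h x hx => ⟨hx.1, hx.2.trans (by exact_mod_cast h)⟩) (by rw [hU]; exact hint n)
    rw [hU] at h1
    have h2 := (Real.continuous_exp.tendsto _).comp ((h1.const_mul (t * C)).neg)
    rw [mul_assoc, ← Real.rpow_eq_const_mul_integral hp (by positivity)] at h2
    refine h2.congr fun N => ?_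
    simp only [Function.comp]
    rw [← Real.exp_add, setIntegral_congr_fun measurableSet_Ioc (fun s hs => heq n s hs.1),
      integral_sub (hpow N) ((hint n).mono_set (hsub N))]
    congr 1
    ring

end CompletelyMonotoneSeq

end CompletelyMonotoneSequences

/-! ### Positivity of a function from its Hausdorff moments. -/

section BernsteinPositivity

open Set Filter Topology unitInterval

/-- The substitution `x ↦ e^{-x}` as a map into the unit interval. -/
noncomputable def expNegUnit (x : ℝ) : I := projIcc 0 1 zero_le_one (Real.exp (-x))

theorem continuous_expNegUnit : Continuous expNegUnit :=
  continuous_projIcc.comp (by fun_prop)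

theorem coe_expNegUnit {x : ℝ} (hx : 0 ≤ x) : (expNegUnit x : ℝ) = Real.exp (-x) := by
  rw [expNegUnit, projIcc_of_mem zero_le_one
    ⟨(Real.exp_pos _).le, Real.exp_le_one_iff.2 (by linarith)⟩]

variable {g : ℝ → ℝ}

theorem integrableOn_continuousMap_mul (hg : IntegrableOn g (Ioi 0)) (f : C(I, ℝ)) :
    IntegrableOn (fun x => f (expNegUnit x) * g x) (Ioi 0) :=
  Integrable.bdd_mul (c := ‖f‖) hg
    (f.continuous.comp continuous_expNegUnit).aestronglyMeasurable
    (.of_forall fun _ => f.norm_coe_le_norm _)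

theorem integral_bernsteinApproximation_nonneg (hg : IntegrableOn g (Ioi 0))
    (h : CompletelyMonotoneSeq fun n => ∫ x in Ioi 0, Real.exp (-x) ^ n * g x)
    (f : C(I, ℝ)) (hf : 0 ≤ f) (N : ℕ) :
    0 ≤ ∫ x in Ioi 0, (bernsteinApproximation N f) (expNegUnit x) * g x := by
  have hE : ∀ n : ℕ, IntegrableOn (fun x => Real.exp (-x) ^ n * g x) (Ioi 0) := fun n =>
    Integrable.bdd_mul (c := 1) hg (by fun_prop) (by
      filter_upwards [ae_restrict_mem measurableSet_Ioi] with x (hx : 0 < x)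
      rw [norm_pow, Real.norm_eq_abs, abs_of_pos (Real.exp_pos _)]
      exact pow_le_one₀ (Real.exp_pos _).le (Real.exp_le_one_iff.2 (by linarith)))
  -- At e^{-x} the Bernstein polynomial is C(N,k) e^{-kx}(1 - e^{-x})^{N-k}, so this integral is
  -- C(N,k) times the (N-k)-th difference of the moments at k.
  have hterm : ∀ k : Fin (N + 1),
      0 ≤ ∫ x in Ioi 0, (bernstein N k (expNegUnit x) * g x) := fun k => by
    have h1 := h (N - k) k
    rw [CompletelyMonotoneSeq.iterate_seqDiff_integral _ hE] at h1
    simp only [CompletelyMonotoneSeq.iterate_seqDiff_pow_mul] at h1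
    have h2 := mul_nonneg (Nat.cast_nonneg (α := ℝ) (N.choose k)) h1
    rw [← integral_const_mul] at h2
    refine h2.trans_eq (setIntegral_congr_fun measurableSet_Ioi fun x (hx : 0 < x) => ?_)
    simp only [bernstein_apply, coe_expNegUnit hx.le]
    ring
  have hsum : ∀ x, (bernsteinApproximation N f) (expNegUnit x) * g x =
      ∑ k : Fin (N + 1), f (bernstein.z k) * (bernstein N k (expNegUnit x) * g x) := fun x => by
    rw [bernsteinApproximation.apply, Finset.sum_mul]
    refine Finset.sum_congr rfl fun k _ => ?_
    rw [smul_eq_mul]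
    ring
  simp only [hsum]
  rw [integral_finsetSum _ fun k _ => (integrableOn_continuousMap_mul hg _).const_mul _]
  refine Finset.sum_nonneg fun k _ => ?_
  rw [integral_const_mul]
  exact mul_nonneg (hf _) (hterm k)

theorem integral_continuousMap_mul_nonneg (hg : IntegrableOn g (Ioi 0))
    (h : CompletelyMonotoneSeq fun n => ∫ x in Ioi 0, Real.exp (-x) ^ n * g x)
    (f : C(I, ℝ)) (hf : 0 ≤ f) :
    0 ≤ ∫ x in Ioi 0, f (expNegUnit x) * g x := by
  have hlim := bernsteinApproximation_uniform f
  refine ge_of_tendsto' (x := atTop) ?_ (integral_bernsteinApproximation_nonneg hg h f hf)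
  refine tendsto_integral_filter_of_dominated_convergence (fun x => (‖f‖ + 1) * ‖g x‖)
    (.of_forall fun N => (integrableOn_continuousMap_mul hg _).aestronglyMeasurable) ?_
    (hg.norm.const_mul _) (.of_forall fun x => ?_)
  · filter_upwards [hlim.norm.eventually_lt_const (lt_add_one ‖f‖)] with N hN
    refine .of_forall fun x => ?_
    rw [norm_mul]
    gcongr
    exact (ContinuousMap.norm_coe_le_norm _ _).trans hN.le
  · exact (((continuous_eval_const (F := C(I, ℝ)) (expNegUnit x)).tendsto f).comp hlim).mul_const _

/-- A continuous function whose Laplace transform is completely monotone along the natural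
numbers is non-negative (Hausdorff's moment problem for the variable `e^{-x}`). -/
theorem nonneg_of_completelyMonotoneSeq_laplace (hg : IntegrableOn g (Ioi 0))
    (hc : ContinuousOn g (Ioi 0))
    (h : CompletelyMonotoneSeq fun n => ∫ x in Ioi 0, Real.exp (-x) ^ n * g x)
    {x₀ : ℝ} (hx₀ : 0 < x₀) : 0 ≤ g x₀ := by
  by_contra! hneg
  have hev : ∀ᶠ x in 𝓝 x₀, 0 < x ∧ g x < 0 :=
    (lt_mem_nhds hx₀).and ((hc.continuousAt (Ioi_mem_nhds hx₀)).eventually_lt_const hneg)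
  obtain ⟨δ, hδ, hball⟩ := Metric.eventually_nhds_iff_ball.1 hev
  -- A tent in the variable u = e^{-x}, positive exactly on the image of the ball where g < 0. Then
  -- f·g ≤ 0 while its integral is non-negative, which forces f·g = 0 almost everywhere.
  let f : C(I, ℝ) := ⟨fun u => max 0 (min ((u : ℝ) - Real.exp (-(x₀ + δ)))
    (Real.exp (-(x₀ - δ)) - u)), by fun_prop⟩
  have hf : 0 ≤ f := fun u => le_max_left _ _
  have hfpos : ∀ x ∈ Metric.ball x₀ δ, 0 < f (expNegUnit x) := fun x hx => by
    have hx0 := (hball x hx).1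
    rw [Metric.mem_ball, Real.dist_eq, abs_lt] at hx
    change 0 < max 0 (min ((expNegUnit x : ℝ) - Real.exp (-(x₀ + δ)))
      (Real.exp (-(x₀ - δ)) - expNegUnit x))
    rw [coe_expNegUnit hx0.le]
    refine lt_max_of_lt_right (lt_min (sub_pos.2 ?_) (sub_pos.2 ?_)) <;>
      apply Real.exp_lt_exp.2 <;> linarith
  have hfzero : ∀ x, 0 < x → x ∉ Metric.ball x₀ δ → f (expNegUnit x) = 0 := fun x hx0 hx => by
    change max 0 (min ((expNegUnit x : ℝ) - Real.exp (-(x₀ + δ)))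
      (Real.exp (-(x₀ - δ)) - expNegUnit x)) = 0
    rw [coe_expNegUnit hx0.le]
    refine max_eq_left ?_
    rw [Metric.mem_ball, Real.dist_eq, not_lt, le_abs] at hx
    rcases hx with hx | hx
    · refine (min_le_left _ _).trans (sub_nonpos.2 (Real.exp_le_exp.2 (by linarith)))
    · refine (min_le_right _ _).trans (sub_nonpos.2 (Real.exp_le_exp.2 (by linarith)))
  have hle : ∀ x, 0 < x → 0 ≤ -(f (expNegUnit x) * g x) := fun x hx0 => by
    by_cases hx : x ∈ Metric.ball x₀ δ
    · exact neg_nonneg.2 (mul_nonpos_of_nonneg_of_nonpos (hf _) (hball x hx).2.le)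
    · simp [hfzero x hx0 hx]
  have hle' : 0 ≤ᵐ[volume.restrict (Ioi 0)] fun x => -(f (expNegUnit x) * g x) := by
    filter_upwards [ae_restrict_mem measurableSet_Ioi] with x hx using hle x hx
  have hint := integrableOn_continuousMap_mul hg f
  have hI : ∫ x in Ioi 0, -(f (expNegUnit x) * g x) = 0 := by
    refine le_antisymm ?_ (integral_nonneg_of_ae hle')
    rw [integral_neg]
    exact neg_nonpos.2 (integral_continuousMap_mul_nonneg hg h f hf)
  rw [integral_eq_zero_iff_of_nonneg_ae hle' hint.neg] at hI
  have hsub : Metric.ball x₀ δ ⊆ Ioi 0 := fun x hx => (hball x hx).1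
  have h2 := ae_restrict_of_ae_restrict_of_subset hsub hI
  have h3 : volume (Metric.ball x₀ δ) = 0 := by
    rw [← Measure.restrict_eq_zero, ← ae_eq_bot, ← eventually_false_iff_eq_bot]
    filter_upwards [h2, ae_restrict_mem measurableSet_ball] with x hx hxb
    have : f (expNegUnit x) * g x < 0 := mul_neg_of_pos_of_neg (hfpos x hxb) (hball x hxb).2
    simp only [Pi.zero_apply, neg_eq_zero] at hx
    exact this.ne hx
  exact (Metric.measure_ball_pos volume x₀ hδ).ne' h3

end BernsteinPositivity

/-! ### The Mellin–Barnes kernel and its Laplace transform. -/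

section BarnesKernel

open Set Filter Topology Complex

/-- The quotient of gamma functions in the Mellin–Barnes integral of the generalized stable law. -/
noncomputable def barnesRatio (α ρ : ℝ) (s : ℂ) : ℂ := Gamma (ρ - s) / Gamma (1 - α * s)

/-- The Mellin–Barnes integral of `barnesRatio` along `Re s = c`. -/
noncomputable def barnesKernel (α ρ c u : ℝ) : ℂ :=
  1 / (2 * Real.pi) * ∫ y : ℝ, barnesRatio α ρ (c + y * I) * (u : ℂ) ^ (-(c + y * I : ℂ))

theorem ofReal_cpow_eq_exp {u : ℝ} (hu : 0 < u) (z : ℂ) : (u : ℂ) ^ z = exp (Real.log u * z) := by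
  rw [cpow_def_of_ne_zero (by exact_mod_cast hu.ne'), ofReal_log hu.le]

theorem foxHIntegrand_eq_barnesRatio (α ρ : ℝ) (z s : ℂ) :
    foxHIntegrand 0 1 ![1 - ρ] ![1] ![0] ![α] z s = barnesRatio α ρ s * z ^ (-s) := by
  simp [foxHIntegrand, barnesRatio]
  ring

theorem foxHLineIntegral_eq_barnesKernel (α ρ c u : ℝ) :
    foxHLineIntegral 0 1 ![1 - ρ] ![1] ![0] ![α] c (u : ℂ) = barnesKernel α ρ c u := by
  simp only [foxHLineIntegral, barnesKernel, foxHIntegrand_eq_barnesRatio]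
  rw [integral_mul_const]
  field_simp

theorem foxHSeparates_iff_lt (α ρ c : ℝ) :
    FoxHSeparates 0 1 ![1 - ρ] ![1] ![0] ![α] c ↔ c < ρ := by
  simp only [FoxHSeparates, not_lt_zero, false_imp_iff, implies_true, true_and, Fin.forall_fin_one]
  constructor
  · intro h
    simpa using h (by simp) 0
  · intro h _ k
    have : (0 : ℝ) ≤ k := k.cast_nonneg
    simp
    linarith

variable {α ρ c : ℝ}

theorem one_sub_mul_pos (hα₀ : 0 < α) (hρ₁ : ρ ≤ 1 / α) (hc : c < ρ) : 0 < 1 - α * c := by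
  have := (lt_div_iff₀ hα₀).1 (hc.trans_le hρ₁)
  linarith

theorem integrable_barnesRatio (hα₀ : 0 < α) (hα₁ : α < 1) (hρ₁ : ρ ≤ 1 / α) (hc : c < ρ) :
    Integrable fun y : ℝ => barnesRatio α ρ (c + y * I) := by
  have hac := one_sub_mul_pos hα₀ hρ₁ hc
  have h1 : ∀ y : ℝ, (ρ - (c + y * I) : ℂ) = ((ρ - c : ℝ) : ℂ) + ((-1 * y : ℝ) : ℂ) * I := by
    intro y; push_cast; ring
  have h2 : ∀ y : ℝ, (1 - α * (c + y * I) : ℂ) =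
      ((1 - α * c : ℝ) : ℂ) + ((-α * y : ℝ) : ℂ) * I := by
    intro y; push_cast; ring
  -- The total rate is -π(1 - α)/2 + ε(1 + α), and this ε keeps it below -π(1 - α)/4.
  have hε : 0 < Real.pi * (1 - α) / 8 := by
    have : 0 < 1 - α := by linarith
    positivity
  obtain ⟨C₁, hC₁, hb₁⟩ := gammaDecay (sub_pos.2 hc) _ hε
  obtain ⟨C₂, hC₂, hb₂⟩ := invGammaGrowth hac _ hε
  refine Integrable.mono' ((integrable_exp_neg_mul_abs (a := Real.pi * (1 - α) / 4)
    (by linarith)).const_mul (C₁ * C₂)) ?_ (.of_forall fun y => ?_)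
  · have hcont : Continuous fun y : ℝ => barnesRatio α ρ (c + y * I) := by
      simp only [barnesRatio, h1, h2]
      exact (continuous_Gamma_line (sub_pos.2 hc) (-1)).div (continuous_Gamma_line hac (-α))
        fun y => Gamma_ne_zero_of_re_pos (by simpa using hac)
    exact hcont.aestronglyMeasurable
  · have e1 := hb₁ (-1 * y)
    have e2 := hb₂ (-α * y)
    rw [← h1] at e1
    rw [← h2] at e2
    rw [barnesRatio, div_eq_mul_inv, norm_mul]
    refine (mul_le_mul e1 e2 (norm_nonneg _) (by positivity)).trans ?_
    rw [mul_mul_mul_comm, ← Real.exp_add, abs_mul, abs_mul, abs_neg, abs_neg, abs_one, one_mul,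
      abs_of_pos hα₀]
    gcongr
    have : 0 ≤ Real.pi * (1 - α) * (1 - α) * |y| := by positivity
    linarith

theorem norm_ofReal_cpow_line {u : ℝ} (hu : 0 < u) (y : ℝ) :
    ‖(u : ℂ) ^ (-(c + y * I : ℂ))‖ = u ^ (-c) := by
  rw [norm_cpow_eq_rpow_re_of_pos hu]
  simp

theorem integrable_barnesIntegrand (hα₀ : 0 < α) (hα₁ : α < 1) (hρ₁ : ρ ≤ 1 / α) (hc : c < ρ)
    {u : ℝ} (hu : 0 < u) :
    Integrable fun y : ℝ => barnesRatio α ρ (c + y * I) * (u : ℂ) ^ (-(c + y * I : ℂ)) := by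
  refine (integrable_barnesRatio hα₀ hα₁ hρ₁ hc).mul_bdd (c := u ^ (-c)) ?_
    (.of_forall fun y => (norm_ofReal_cpow_line hu y).le)
  simp only [ofReal_cpow_eq_exp hu]
  exact Continuous.aestronglyMeasurable (by fun_prop)

/-- All parameters are real, so conjugation amounts to y ↦ -y. Hence passing to the real part later
loses nothing. -/
theorem conj_barnesKernel {u : ℝ} (hu : 0 < u) :
    (starRingEnd ℂ) (barnesKernel α ρ c u) = barnesKernel α ρ c u := by
  have hconj : ∀ y : ℝ, (starRingEnd ℂ) (c + y * I) = c + (-y : ℝ) * I := fun y => by simp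
  rw [barnesKernel, map_mul, ← integral_conj, ← integral_neg_eq_self]
  congr 1
  · simp [map_ofNat]
  · refine integral_congr_ae (.of_forall fun y => ?_)
    simp only [ofReal_cpow_eq_exp hu, barnesRatio, map_mul, map_div₀, ← Gamma_conj, ← exp_conj,
      map_sub, map_neg, hconj, conj_ofReal, map_one, neg_neg]

theorem ofReal_re_barnesKernel {u : ℝ} (hu : 0 < u) :
    ((barnesKernel α ρ c u).re : ℂ) = barnesKernel α ρ c u :=
  conj_eq_iff_re.1 (conj_barnesKernel hu)

theorem continuousOn_barnesKernel (hα₀ : 0 < α) (hα₁ : α < 1) (hρ₁ : ρ ≤ 1 / α) (hc : c < ρ) :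
    ContinuousOn (barnesKernel α ρ c) (Ioi 0) := by
  -- In L = log u the kernel is e^{-cL} times the Fourier integral of an integrable function.
  have hG : Continuous fun L : ℝ =>
      ∫ y : ℝ, barnesRatio α ρ (c + y * I) * exp ((-(L * y) : ℝ) * I) := by
    have hM := integrable_barnesRatio hα₀ hα₁ hρ₁ hc
    refine continuous_of_dominated (bound := fun y => ‖barnesRatio α ρ (c + y * I)‖)
      (fun L => hM.aestronglyMeasurable.mul
        (Continuous.aestronglyMeasurable (by fun_prop)))
      (fun L => .of_forall fun y => ?_) hM.norm (.of_forall fun y => by fun_prop)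
    rw [norm_mul, norm_exp_ofReal_mul_I, mul_one]
  have hlog : ContinuousOn Real.log (Ioi 0) :=
    Real.continuousOn_log.mono fun x hx => ne_of_gt hx
  have h : ContinuousOn (fun u : ℝ => 1 / (2 * Real.pi) * (exp (-(c * Real.log u : ℝ)) *
      ∫ y : ℝ, barnesRatio α ρ (c + y * I) * exp ((-(Real.log u * y) : ℝ) * I))) (Ioi 0) := by
    refine continuousOn_const.mul (ContinuousOn.mul ?_ (hG.comp_continuousOn hlog))
    fun_prop
  refine h.congr fun u hu => ?_
  simp only [barnesKernel]
  congr 1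
  rw [← integral_const_mul (exp (-(c * Real.log u : ℝ)))]
  refine integral_congr_ae (.of_forall fun y => ?_)
  simp only [ofReal_cpow_eq_exp hu]
  rw [mul_left_comm, ← exp_add]
  congr 2
  push_cast
  ring

/-- Mellin inversion for `Γ`. -/
theorem integral_cpow_mul_Gamma_line {σ w : ℝ} (hσ : 0 < σ) (hw : 0 < w) :
    1 / (2 * Real.pi) * ∫ y : ℝ, (w : ℂ) ^ (-(σ + y * I : ℂ)) * Gamma (σ + y * I) =
      exp (-w) := by
  have hG : ∀ y : ℝ, mellin (fun x : ℝ => ((Real.exp (-x) : ℝ) : ℂ)) (σ + y * I) =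
      Gamma (σ + y * I) := fun y => by
    rw [← GammaIntegral_eq_mellin, Gamma_eq_integral (by simpa using hσ)]
  have h := mellinInv_mellin_eq σ (fun x : ℝ => ((Real.exp (-x) : ℝ) : ℂ)) hw ?_ ?_ ?_
  · simp only [mellinInv, hG, smul_eq_mul] at h
    rw [real_smul] at h
    push_cast at h
    exact h
  · have := GammaIntegral_convergent (s := (σ : ℂ)) (by simpa using hσ)
    refine this.congr_fun (fun x _ => ?_) measurableSet_Ioi
    simp [mul_comm]
  · refine (integrable_Gamma_line hσ).congr (.of_forall fun y => (hG y).symm)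
  · fun_prop

/-- Since |u^{-s}| depends only on Re s, the modulus is a product of a function of x and one of y;
the x-factor is integrable at 0 because αc < 1. -/
theorem integrable_exp_mul_barnesIntegrand_prod (hα₀ : 0 < α) (hα₁ : α < 1) (hρ₁ : ρ ≤ 1 / α)
    (hc : c < ρ) {t η : ℝ} (ht : 0 < t) (hη : 0 < η) :
    Integrable (fun p : ℝ × ℝ => (Real.exp (-(η * p.1)) : ℂ) *
      (barnesRatio α ρ (c + p.2 * I) * ((p.1 ^ α / t : ℝ) : ℂ) ^ (-(c + p.2 * I : ℂ))))
      ((volume.restrict (Ioi 0)).prod volume) := by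
  have hM := integrable_barnesRatio hα₀ hα₁ hρ₁ hc
  have hac := one_sub_mul_pos hα₀ hρ₁ hc
  have hx : IntegrableOn (fun x : ℝ => x ^ (1 - α * c - 1) * Real.exp (-(η * x))) (Ioi 0) := by
    by_contra hn
    have h1 := Real.integral_rpow_mul_exp_neg_mul_Ioi hac hη
    rw [integral_undef hn] at h1
    exact (mul_pos (Real.rpow_pos_of_pos (one_div_pos.2 hη) _)
      (Real.Gamma_pos_of_pos hac)).ne h1
  have hprod := (hx.const_mul (t ^ c)).mul_prod hM.norm
  refine hprod.mono' ?_ ?_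
  · refine AEStronglyMeasurable.mul (Continuous.aestronglyMeasurable (by fun_prop))
      (AEStronglyMeasurable.mul hM.aestronglyMeasurable.comp_snd ?_)
    exact Measurable.aestronglyMeasurable (by fun_prop)
  · have hmem : ∀ᵐ p : ℝ × ℝ ∂((volume.restrict (Ioi 0)).prod volume), p.1 ∈ Ioi (0 : ℝ) :=
      Measure.quasiMeasurePreserving_fst.ae (ae_restrict_mem measurableSet_Ioi)
    filter_upwards [hmem] with p (hp : 0 < p.1)
    have hu : 0 < p.1 ^ α / t := div_pos (Real.rpow_pos_of_pos hp _) ht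
    rw [norm_mul, norm_mul, norm_ofReal_cpow_line hu, norm_real, Real.norm_eq_abs,
      abs_of_pos (Real.exp_pos _), Real.div_rpow (Real.rpow_pos_of_pos hp _).le ht.le,
      ← Real.rpow_mul hp.le, Real.rpow_neg ht.le, div_inv_eq_mul]
    refine le_of_eq ?_
    have : 1 - α * c - 1 = α * -c := by ring
    rw [this]
    ring

/-- Euler's integral produces Γ(1 - αs), which cancels the denominator. The rest is arranged as
w^{-(ρ-s)}Γ(ρ - s) with w = η^α t, ready for Mellin inversion at abscissa ρ - c. -/
theorem integral_exp_mul_cpow_line (hα₀ : 0 < α) (hρ₁ : ρ ≤ 1 / α) (hc : c < ρ)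
    {t η : ℝ} (ht : 0 < t) (hη : 0 < η) (y : ℝ) :
    ∫ x in Ioi (0 : ℝ), (Real.exp (-(η * x)) : ℂ) *
      (barnesRatio α ρ (c + y * I) * ((x ^ α / t : ℝ) : ℂ) ^ (-(c + y * I : ℂ))) =
    (η⁻¹ * (η ^ α * t) ^ ρ : ℝ) * (((η ^ α * t : ℝ) : ℂ) ^ (-((ρ - c : ℝ) + (-y : ℝ) * I : ℂ)) *
      Gamma ((ρ - c : ℝ) + (-y : ℝ) * I)) := by
  have hac := one_sub_mul_pos hα₀ hρ₁ hc
  set s : ℂ := c + y * I with hs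
  have hre : 0 < (1 - α * s).re := by simpa [hs] using hac
  have hΓ : Gamma (1 - α * s) ≠ 0 := Gamma_ne_zero_of_re_pos hre
  have hw : 0 < η ^ α * t := mul_pos (Real.rpow_pos_of_pos hη _) ht
  have h1 : ((ρ - c : ℝ) + (-y : ℝ) * I : ℂ) = ρ - s := by
    rw [hs]; push_cast; ring
  have h2 : ∀ x ∈ Ioi (0 : ℝ), (Real.exp (-(η * x)) : ℂ) *
      (barnesRatio α ρ s * ((x ^ α / t : ℝ) : ℂ) ^ (-s)) =
      (barnesRatio α ρ s * exp (Real.log t * s)) *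
        ((x : ℂ) ^ ((1 - α * s) - 1) * exp (-(η * x))) := fun x (hx : 0 < x) => by
    have hu : 0 < x ^ α / t := div_pos (Real.rpow_pos_of_pos hx _) ht
    rw [ofReal_cpow_eq_exp hu, ofReal_cpow_eq_exp hx, Real.log_div
      (Real.rpow_pos_of_pos hx _).ne' ht.ne', Real.log_rpow hx]
    have e1 : ((α * Real.log x - Real.log t : ℝ) : ℂ) * -s =
        Real.log t * s + Real.log x * (1 - α * s - 1) := by push_cast; ring
    rw [e1, exp_add]
    push_cast
    ring
  rw [setIntegral_congr_fun measurableSet_Ioi h2, integral_const_mul,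
    integral_cpow_mul_exp_neg_mul_Ioi hre hη, h1, barnesRatio]
  have h3 : (1 / η : ℂ) = ((1 / η : ℝ) : ℂ) := by push_cast; rfl
  have h4 : ((η⁻¹ * (η ^ α * t) ^ ρ : ℝ) : ℂ) =
      exp (-Real.log η + (α * Real.log η + Real.log t) * ρ) := by
    have : η⁻¹ * (η ^ α * t) ^ ρ =
        Real.exp (-Real.log η + (α * Real.log η + Real.log t) * ρ) := by
      rw [Real.exp_add, Real.exp_neg, Real.exp_log hη, Real.rpow_def_of_pos hw,
        Real.log_mul (Real.rpow_pos_of_pos hη _).ne' ht.ne', Real.log_rpow hη]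
    rw [this]
    push_cast
    rfl
  rw [h3, ofReal_cpow_eq_exp (one_div_pos.2 hη), ofReal_cpow_eq_exp hw, h4, Real.log_div one_ne_zero
    hη.ne', Real.log_one, Real.log_mul (Real.rpow_pos_of_pos hη _).ne' ht.ne', Real.log_rpow hη]
  rw [← mul_assoc (exp _) (exp _), ← exp_add]
  have h5 : ∀ a b d e f : ℂ, f ≠ 0 → a / f * b * (d * f) = b * d * a := by
    intro a b d e f hf
    field_simp
  rw [h5 _ _ _ 0 _ hΓ, ← exp_add]
  congr 2
  push_cast
  ring

/-- The Mellin–Barnes integral at `x ^ α / t`: up to the factor `-α / Γ(ρ)`, its Laplace transform is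
the derivative of that of the generalized stable law. -/
noncomputable def barnesDensity (α ρ c t x : ℝ) : ℝ := (barnesKernel α ρ c (x ^ α / t)).re

theorem integrableOn_exp_mul_barnesDensity (hα₀ : 0 < α) (hα₁ : α < 1) (hρ₁ : ρ ≤ 1 / α)
    (hc : c < ρ) {t η : ℝ} (ht : 0 < t) (hη : 0 < η) :
    IntegrableOn (fun x => Real.exp (-(η * x)) * barnesDensity α ρ c t x) (Ioi 0) := by
  have h := ((integrable_exp_mul_barnesIntegrand_prod hα₀ hα₁ hρ₁ hc ht
    hη).integral_prod_left).const_mul (1 / (2 * Real.pi) : ℂ)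
  refine h.re.congr (.of_forall fun x => ?_)
  simp only [barnesDensity, barnesKernel]
  rw [integral_const_mul, mul_left_comm]
  exact re_ofReal_mul _ _

theorem integral_exp_mul_barnesDensity (hα₀ : 0 < α) (hα₁ : α < 1) (hρ₁ : ρ ≤ 1 / α)
    (hc : c < ρ) {t η : ℝ} (ht : 0 < t) (hη : 0 < η) :
    ∫ x in Ioi 0, Real.exp (-(η * x)) * barnesDensity α ρ c t x =
      η⁻¹ * (η ^ α * t) ^ ρ * Real.exp (-(η ^ α * t)) := by
  have hw : 0 < η ^ α * t := mul_pos (Real.rpow_pos_of_pos hη _) ht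
  have hF := integrable_exp_mul_barnesIntegrand_prod hα₀ hα₁ hρ₁ hc ht hη
  have hswap := integral_integral_swap (f := fun x y : ℝ => (Real.exp (-(η * x)) : ℂ) *
    (barnesRatio α ρ (c + y * I) * ((x ^ α / t : ℝ) : ℂ) ^ (-(c + y * I : ℂ)))) hF
  simp only [integral_exp_mul_cpow_line hα₀ hρ₁ hc ht hη] at hswap
  rw [integral_const_mul, integral_neg_eq_self (fun y : ℝ =>
    ((η ^ α * t : ℝ) : ℂ) ^ (-((ρ - c : ℝ) + (y : ℝ) * I : ℂ)) *
      Gamma ((ρ - c : ℝ) + (y : ℝ) * I))] at hswap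
  have hinv := integral_cpow_mul_Gamma_line (sub_pos.2 hc) hw
  apply ofReal_injective
  rw [← integral_complex_ofReal]
  calc _ = 1 / (2 * Real.pi) * ∫ x in Ioi (0 : ℝ), ∫ y : ℝ, (Real.exp (-(η * x)) : ℂ) *
        (barnesRatio α ρ (c + y * I) * ((x ^ α / t : ℝ) : ℂ) ^ (-(c + y * I : ℂ))) := by
        rw [← integral_const_mul]
        refine setIntegral_congr_fun measurableSet_Ioi fun x (hx : 0 < x) => ?_
        have hu : 0 < x ^ α / t := div_pos (Real.rpow_pos_of_pos hx _) ht
        simp only [barnesDensity]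
        rw [ofReal_mul, ofReal_re_barnesKernel hu, integral_const_mul, barnesKernel]
        ring
    _ = _ := by
        rw [hswap, mul_left_comm, hinv]
        push_cast
        rfl

end BarnesKernel

/-! ### Positivity, independence of the line, and the density. -/

section GenStableDensity

open Set Filter Topology

variable {α ρ c : ℝ}

theorem continuousOn_barnesDensity (hα₀ : 0 < α) (hα₁ : α < 1) (hρ₁ : ρ ≤ 1 / α) (hc : c < ρ)
    {t : ℝ} (ht : 0 < t) : ContinuousOn (barnesDensity α ρ c t) (Ioi 0) := by
  have h1 : ContinuousOn (fun x : ℝ => x ^ α / t) (Ioi 0) :=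
    (continuousOn_id.rpow_const fun x hx => Or.inl (ne_of_gt hx)).div_const t
  exact Complex.continuous_re.comp_continuousOn
    ((continuousOn_barnesKernel hα₀ hα₁ hρ₁ hc).comp h1
      fun x hx => div_pos (Real.rpow_pos_of_pos hx _) ht)

theorem completelyMonotoneSeq_laplace_barnesDensity (hα₀ : 0 < α) (hα₁ : α < 1) (hρ₁ : ρ ≤ 1 / α)
    {t : ℝ} (ht : 0 < t) :
    CompletelyMonotoneSeq fun n : ℕ => ((n : ℝ) + 1)⁻¹ * (((n : ℝ) + 1) ^ α * t) ^ ρ *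
      Real.exp (-(((n : ℝ) + 1) ^ α * t)) := by
  have hαρ : 0 ≤ 1 - α * ρ := by
    have := (le_div_iff₀ hα₀).1 hρ₁
    linarith
  have hpow : CompletelyMonotoneSeq fun n : ℕ => (1 / (0 + ((n : ℝ) + 1))) ^ (1 - α * ρ) := by
    -- The factor η^{αρ-1} is where ρ ≤ 1/α yields complete monotonicity; at αρ = 1 it is constant
    -- and Euler's integral does not apply.
    rcases hαρ.eq_or_lt with h | h
    · simpa only [← h, Real.rpow_zero] using CompletelyMonotoneSeq.const zero_le_one
    · exact CompletelyMonotoneSeq.one_div_add_rpow le_rfl h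
  have h := (hpow.mul (CompletelyMonotoneSeq.exp_neg_mul_rpow ⟨hα₀, hα₁⟩ ht.le)).const_mul
    (Real.rpow_nonneg ht.le ρ)
  convert h using 2 with n
  have hn : (0 : ℝ) < (n : ℝ) + 1 := by positivity
  simp only [Pi.mul_apply]
  rw [zero_add, one_div, Real.inv_rpow hn.le, ← Real.rpow_neg hn.le, neg_sub, Real.rpow_sub hn,
    Real.rpow_one, Real.mul_rpow (Real.rpow_nonneg hn.le _) ht.le, ← Real.rpow_mul hn.le,
    mul_comm t]
  ring

/-- The extra weight e^{-x} secures integrability and shifts the sampling points from n to n + 1. -/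
theorem integral_exp_pow_mul_barnesDensity (hα₀ : 0 < α) (hα₁ : α < 1) (hρ₁ : ρ ≤ 1 / α)
    (hc : c < ρ) {t : ℝ} (ht : 0 < t) (n : ℕ) :
    ∫ x in Ioi 0, Real.exp (-x) ^ n * (Real.exp (-(1 * x)) * barnesDensity α ρ c t x) =
      ((n : ℝ) + 1)⁻¹ * (((n : ℝ) + 1) ^ α * t) ^ ρ * Real.exp (-(((n : ℝ) + 1) ^ α * t)) := by
  rw [← integral_exp_mul_barnesDensity hα₀ hα₁ hρ₁ hc ht (by positivity : (0 : ℝ) < (n : ℝ) + 1)]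
  refine setIntegral_congr_fun measurableSet_Ioi fun x _ => ?_
  rw [← mul_assoc, ← Real.exp_nat_mul, ← Real.exp_add]
  congr 2
  ring

theorem barnesDensity_nonneg (hα₀ : 0 < α) (hα₁ : α < 1) (hρ₁ : ρ ≤ 1 / α) (hc : c < ρ)
    {t x : ℝ} (ht : 0 < t) (hx : 0 < x) : 0 ≤ barnesDensity α ρ c t x := by
  have h := nonneg_of_completelyMonotoneSeq_laplace
    (integrableOn_exp_mul_barnesDensity hα₀ hα₁ hρ₁ hc ht one_pos)
    (ContinuousOn.mul (by fun_prop) (continuousOn_barnesDensity hα₀ hα₁ hρ₁ hc ht))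
    (by
      simp only [integral_exp_pow_mul_barnesDensity hα₀ hα₁ hρ₁ hc ht]
      exact completelyMonotoneSeq_laplace_barnesDensity hα₀ hα₁ hρ₁ ht) hx
  exact nonneg_of_mul_nonneg_right h (Real.exp_pos _)

/-- One half of the independence of the Mellin–Barnes integral of the line. -/
theorem barnesDensity_le_of_lines (hα₀ : 0 < α) (hα₁ : α < 1) (hρ₁ : ρ ≤ 1 / α) {d : ℝ}
    (hc : c < ρ) (hd : d < ρ) {t x : ℝ} (ht : 0 < t) (hx : 0 < x) :
    barnesDensity α ρ c t x ≤ barnesDensity α ρ d t x := by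
  have hic := integrableOn_exp_mul_barnesDensity hα₀ hα₁ hρ₁ hc ht one_pos
  have hid := integrableOn_exp_mul_barnesDensity hα₀ hα₁ hρ₁ hd ht one_pos
  have hE : ∀ {e : ℝ} (n : ℕ), e < ρ → IntegrableOn
      (fun x => Real.exp (-x) ^ n * (Real.exp (-(1 * x)) * barnesDensity α ρ e t x)) (Ioi 0) := by
    intro e n he
    refine (integrableOn_exp_mul_barnesDensity hα₀ hα₁ hρ₁ he ht
      (by positivity : (0 : ℝ) < (n : ℝ) + 1)).congr_fun (fun x _ => ?_) measurableSet_Ioi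
    simp only
    rw [← mul_assoc, ← Real.exp_nat_mul, ← Real.exp_add]
    congr 2
    ring
  -- All moments of the difference vanish, and the zero sequence is completely monotone.
  have h := nonneg_of_completelyMonotoneSeq_laplace (hid.sub hic)
    (ContinuousOn.sub
      (ContinuousOn.mul (by fun_prop) (continuousOn_barnesDensity hα₀ hα₁ hρ₁ hd ht))
      (ContinuousOn.mul (by fun_prop) (continuousOn_barnesDensity hα₀ hα₁ hρ₁ hc ht)))
    (by
      simp only [Pi.sub_apply, mul_sub]
      convert CompletelyMonotoneSeq.const le_rfl using 2 with n
      rw [integral_sub (hE n hd) (hE n hc), integral_exp_pow_mul_barnesDensity hα₀ hα₁ hρ₁ hc ht,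
        integral_exp_pow_mul_barnesDensity hα₀ hα₁ hρ₁ hd ht, sub_self]) hx
  simp only [Pi.sub_apply, ← mul_sub] at h
  exact sub_nonneg.1 (nonneg_of_mul_nonneg_right h (Real.exp_pos _))

theorem barnesDensity_eq_of_lines (hα₀ : 0 < α) (hα₁ : α < 1) (hρ₁ : ρ ≤ 1 / α) {d : ℝ}
    (hc : c < ρ) (hd : d < ρ) {t x : ℝ} (ht : 0 < t) (hx : 0 < x) :
    barnesDensity α ρ c t x = barnesDensity α ρ d t x :=
  (barnesDensity_le_of_lines hα₀ hα₁ hρ₁ hc hd ht hx).antisymm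
    (barnesDensity_le_of_lines hα₀ hα₁ hρ₁ hd hc ht hx)

theorem barnesKernel_eq_barnesDensity (hα₀ : 0 < α) (hα₁ : α < 1) (hρ₁ : ρ ≤ 1 / α) {d : ℝ}
    (hc : c < ρ) (hd : d < ρ) {t x : ℝ} (ht : 0 < t) (hx : 0 < x) :
    barnesKernel α ρ c (x ^ α / t) = (barnesDensity α ρ d t x : ℂ) := by
  rw [← barnesDensity_eq_of_lines hα₀ hα₁ hρ₁ hc hd ht hx, barnesDensity,
    ofReal_re_barnesKernel (div_pos (Real.rpow_pos_of_pos hx _) ht)]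

/-- The density of the generalized stable law at time `t`. -/
noncomputable def genStableDensity (α ρ x t : ℝ) : ℝ :=
  (Ioi 0).indicator (fun x => α / (x * Real.Gamma ρ) * barnesDensity α ρ 0 t x) x

theorem genStableDensity_of_pos {t x : ℝ} (hx : 0 < x) :
    genStableDensity α ρ x t = α / (x * Real.Gamma ρ) * barnesDensity α ρ 0 t x :=
  indicator_of_mem hx _

theorem genStableDensity_of_nonpos {t x : ℝ} (hx : x ≤ 0) : genStableDensity α ρ x t = 0 :=
  indicator_of_notMem (by simpa using hx) _

theorem genStableDensity_nonneg (hα₀ : 0 < α) (hα₁ : α < 1) (hρ₀ : 0 < ρ) (hρ₁ : ρ ≤ 1 / α)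
    {t : ℝ} (ht : 0 < t) (x : ℝ) : 0 ≤ genStableDensity α ρ x t := by
  rcases le_or_gt x 0 with hx | hx
  · rw [genStableDensity_of_nonpos hx]
  · rw [genStableDensity_of_pos hx]
    have := Real.Gamma_pos_of_pos hρ₀
    exact mul_nonneg (by positivity) (barnesDensity_nonneg hα₀ hα₁ hρ₁ hρ₀ ht hx)

theorem measurable_genStableDensity (hα₀ : 0 < α) (hα₁ : α < 1) (hρ₀ : 0 < ρ) (hρ₁ : ρ ≤ 1 / α)
    {t : ℝ} (ht : 0 < t) : Measurable fun x => genStableDensity α ρ x t := by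
  have hG := (Real.Gamma_pos_of_pos hρ₀).ne'
  have hc : ContinuousOn (fun x => α / (x * Real.Gamma ρ) * barnesDensity α ρ 0 t x) (Ioi 0) :=
    (continuousOn_const.div (by fun_prop) fun x (hx : 0 < x) => mul_ne_zero hx.ne' hG).mul
      (continuousOn_barnesDensity hα₀ hα₁ hρ₁ hρ₀ ht)
  have := hc.measurable_piecewise (continuousOn_const (c := (0 : ℝ)) (s := (Ioi (0 : ℝ))ᶜ))
    measurableSet_Ioi
  classical
  convert this using 1
  funext x
  simp only [genStableDensity, indicator, piecewise]

/-- Tonelli's theorem: the Laplace transform of the density is the integral of that of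
`barnesDensity`. -/
theorem lintegral_exp_mul_genStableDensity (hα₀ : 0 < α) (hα₁ : α < 1) (hρ₀ : 0 < ρ)
    (hρ₁ : ρ ≤ 1 / α) {t η : ℝ} (ht : 0 < t) (hη : 0 ≤ η) :
    ∫⁻ x, ENNReal.ofReal (Real.exp (-(η * x)) * genStableDensity α ρ x t) =
      ∫⁻ u in Ioi η, ENNReal.ofReal (α / Real.Gamma ρ *
        (u⁻¹ * (u ^ α * t) ^ ρ * Real.exp (-(u ^ α * t)))) := by
  have hG := Real.Gamma_pos_of_pos hρ₀
  have hκ := fun {x : ℝ} (hx : 0 < x) => barnesDensity_nonneg hα₀ hα₁ hρ₁ hρ₀ ht hx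
  have h1 : ∀ u ∈ Ioi η, ENNReal.ofReal (α / Real.Gamma ρ *
        (u⁻¹ * (u ^ α * t) ^ ρ * Real.exp (-(u ^ α * t)))) =
      ∫⁻ x in Ioi 0, ENNReal.ofReal (α / Real.Gamma ρ *
        (Real.exp (-(u * x)) * barnesDensity α ρ 0 t x)) := fun u (hu : η < u) => by
    have hu0 := hη.trans_lt hu
    rw [← integral_exp_mul_barnesDensity hα₀ hα₁ hρ₁ hρ₀ ht hu0, ← integral_const_mul,
      ofReal_integral_eq_lintegral_ofReal
        ((integrableOn_exp_mul_barnesDensity hα₀ hα₁ hρ₁ hρ₀ ht hu0).const_mul _)]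
    filter_upwards [ae_restrict_mem measurableSet_Ioi] with x (hx : 0 < x)
    have := hκ hx
    positivity
  -- The integral of e^{-ux} over u > η is e^{-ηx}/x, the source of the factor 1/x in the density.
  have h2 : ∀ x ∈ Ioi (0 : ℝ), ∫⁻ u in Ioi η, ENNReal.ofReal (α / Real.Gamma ρ *
        (Real.exp (-(u * x)) * barnesDensity α ρ 0 t x)) =
      ENNReal.ofReal (Real.exp (-(η * x)) * genStableDensity α ρ x t) := fun x (hx : 0 < x) => by
    have hint := integrableOn_exp_mul_Ioi (neg_lt_zero.2 hx) η
    have hval := integral_exp_mul_Ioi (neg_lt_zero.2 hx) η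
    have hrw : (fun u : ℝ => α / Real.Gamma ρ * (Real.exp (-(u * x)) * barnesDensity α ρ 0 t x)) =
        fun u => (α / Real.Gamma ρ * barnesDensity α ρ 0 t x) * Real.exp (-x * u) := by
      funext u
      rw [show -(u * x) = -x * u by ring]
      ring
    simp only [fun u => congrFun hrw u]
    rw [← ofReal_integral_eq_lintegral_ofReal (hint.const_mul _), integral_const_mul, hval,
      genStableDensity_of_pos hx]
    · congr 1
      rw [show -(η * x) = -x * η by ring]
      field_simp
    · have := hκ hx
      exact .of_forall fun u => by positivity
  rw [setLIntegral_congr_fun measurableSet_Ioi h1, lintegral_lintegral_swap,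
    setLIntegral_congr_fun measurableSet_Ioi h2, ← lintegral_indicator measurableSet_Ioi]
  · refine lintegral_congr fun x => ?_
    rcases le_or_gt x 0 with hx | hx
    · rw [genStableDensity_of_nonpos hx, indicator_of_notMem (by simpa using hx)]
      simp
    · rw [indicator_of_mem (mem_Ioi.2 hx)]
  · have hm : AEMeasurable (barnesDensity α ρ 0 t) (volume.restrict (Ioi 0)) :=
      ((continuousOn_barnesDensity hα₀ hα₁ hρ₁ hρ₀ ht).aestronglyMeasurable
        measurableSet_Ioi).aemeasurable
    refine AEMeasurable.ennreal_ofReal (AEMeasurable.const_mul (AEMeasurable.mul ?_ hm.comp_snd) _)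
    exact Measurable.aemeasurable (by fun_prop)

theorem integrableOn_upperIncompleteGamma (hρ₀ : 0 < ρ) {y : ℝ} (hy : 0 ≤ y) :
    IntegrableOn (fun w : ℝ => Real.exp (-w) * w ^ (ρ - 1)) (Ioi y) :=
  (Real.GammaIntegral_convergent hρ₀).mono_set (Ioi_subset_Ioi hy)

theorem image_rpow_mul_Ioi (hα₀ : 0 < α) {t η : ℝ} (ht : 0 < t) (hη : 0 ≤ η) :
    (fun u : ℝ => u ^ α * t) '' Ioi η = Ioi (η ^ α * t) := by
  ext w
  simp only [mem_image, mem_Ioi]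
  constructor
  · rintro ⟨u, hu, rfl⟩
    exact mul_lt_mul_of_pos_right (Real.rpow_lt_rpow hη hu hα₀) ht
  · intro hw
    have hηα : 0 ≤ η ^ α := Real.rpow_nonneg hη _
    have hw0 : 0 < w := (mul_nonneg hηα ht.le).trans_lt hw
    have hwt : 0 < w / t := div_pos hw0 ht
    refine ⟨(w / t) ^ (1 / α), ?_, ?_⟩
    · have h1 : η ^ α < w / t := (lt_div_iff₀ ht).2 hw
      have h2 := Real.rpow_lt_rpow hηα h1 (one_div_pos.2 hα₀)
      rwa [← Real.rpow_mul hη, mul_one_div_cancel hα₀.ne', Real.rpow_one] at h2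
    · rw [← Real.rpow_mul hwt.le, one_div_mul_cancel hα₀.ne', Real.rpow_one,
        div_mul_cancel₀ _ ht.ne']

/-- Substitution w = u^α t, for which dw/w = α du/u. -/
theorem lintegral_eq_upperIncompleteGamma (hα₀ : 0 < α) (hρ₀ : 0 < ρ)
    {t η : ℝ} (ht : 0 < t) (hη : 0 ≤ η) :
    ∫⁻ u in Ioi η, ENNReal.ofReal (α / Real.Gamma ρ *
        (u⁻¹ * (u ^ α * t) ^ ρ * Real.exp (-(u ^ α * t)))) =
      ENNReal.ofReal (upperIncompleteGamma ρ (η ^ α * t) / Real.Gamma ρ) := by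
  have hG := Real.Gamma_pos_of_pos hρ₀
  have hy : 0 ≤ η ^ α * t := mul_nonneg (Real.rpow_nonneg hη _) ht.le
  rw [upperIncompleteGamma, div_eq_inv_mul (∫ w in Ioi _, _) (Real.Gamma ρ),
    ← integral_const_mul,
    ofReal_integral_eq_lintegral_ofReal ((integrableOn_upperIncompleteGamma hρ₀ hy).const_mul _)]
  · rw [← image_rpow_mul_Ioi hα₀ ht hη, lintegral_image_eq_lintegral_abs_deriv_mul
      (f' := fun u => α * u ^ (α - 1) * t) measurableSet_Ioi]
    · refine setLIntegral_congr_fun measurableSet_Ioi fun u (hu : η < u) => ?_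
      have hu0 := hη.trans_lt hu
      have hua : 0 < u ^ (α - 1) := Real.rpow_pos_of_pos hu0 _
      have hw : 0 < u ^ α * t := mul_pos (Real.rpow_pos_of_pos hu0 _) ht
      rw [abs_of_pos (by positivity), ← ENNReal.ofReal_mul (by positivity)]
      congr 1
      rw [Real.rpow_sub_one hw.ne', Real.rpow_sub_one hu0.ne']
      have : 0 < u ^ α := Real.rpow_pos_of_pos hu0 _
      field_simp
    · intro u hu
      have hu0 : 0 < u := hη.trans_lt hu
      exact ((Real.hasDerivAt_rpow_const (Or.inl hu0.ne')).mul_const t).hasDerivWithinAt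
    · intro u hu v hv huv
      have hu0 : 0 < u := hη.trans_lt hu
      have hv0 : 0 < v := hη.trans_lt hv
      exact (Real.rpow_left_inj hu0.le hv0.le hα₀.ne').1 (mul_right_cancel₀ ht.ne' huv)
  · filter_upwards [ae_restrict_mem measurableSet_Ioi] with w hw
    have hw0 : 0 < w := hy.trans_lt hw
    have := Real.rpow_pos_of_pos hw0 (ρ - 1)
    positivity

theorem isGenStableLaw_genStableDensity (hα₀ : 0 < α) (hα₁ : α < 1) (hρ₀ : 0 < ρ)
    (hρ₁ : ρ ≤ 1 / α) {t : ℝ} (ht : 0 < t) :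
    IsGenStableLaw α ρ t
      (volume.withDensity fun x => ENNReal.ofReal (genStableDensity α ρ x t)) := by
  have hG := Real.Gamma_pos_of_pos hρ₀
  have hm := (measurable_genStableDensity hα₀ hα₁ hρ₀ hρ₁ ht).ennreal_ofReal
  have hl := fun {η : ℝ} (hη : 0 ≤ η) =>
    (lintegral_exp_mul_genStableDensity hα₀ hα₁ hρ₀ hρ₁ ht hη).trans
      (lintegral_eq_upperIncompleteGamma hα₀ hρ₀ ht hη)
  refine ⟨⟨?_⟩, ?_, fun η hη => ?_⟩
  · have h0 := hl le_rfl
    simp only [zero_mul, neg_zero, Real.exp_zero, one_mul, Real.zero_rpow hα₀.ne'] at h0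
    rw [withDensity_apply _ MeasurableSet.univ, setLIntegral_univ, h0, upperIncompleteGamma,
      ← Real.Gamma_eq_integral hρ₀, div_self hG.ne', ENNReal.ofReal_one]
  · rw [ae_withDensity_iff hm]
    refine .of_forall fun x hx => ?_
    by_contra! hneg
    exact hx (by rw [genStableDensity_of_nonpos hneg.le, ENNReal.ofReal_zero])
  · have hu : 0 ≤ upperIncompleteGamma ρ (η ^ α * t) / Real.Gamma ρ := by
      refine div_nonneg (setIntegral_nonneg measurableSet_Ioi fun w hw => ?_) hG.le
      have hw0 : 0 ≤ w := (mul_nonneg (Real.rpow_nonneg hη.le _) ht.le).trans (le_of_lt hw)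
      exact mul_nonneg (Real.exp_pos _).le (Real.rpow_nonneg hw0 _)
    rw [integral_eq_lintegral_of_nonneg_ae (.of_forall fun x => (Real.exp_pos _).le)
      (by fun_prop), lintegral_withDensity_eq_lintegral_mul _ hm (by fun_prop),
      ← ENNReal.toReal_ofReal hu, ← hl hη.le]
    congr 1
    refine lintegral_congr fun x => ?_
    rw [Pi.mul_apply, mul_comm, ENNReal.ofReal_mul (Real.exp_pos _).le]

end GenStableDensity

/-! ### Uniqueness of the law from its Laplace transform. -/

section LaplaceUniqueness

open Set Filter Topology Polynomial BoundedContinuousFunction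

/-- The polynomials in `x ↦ e^{-x}` as an algebra of bounded continuous functions on `[0, ∞)`. -/
noncomputable def expPolynomials : StarSubalgebra ℝ (NNReal →ᵇ ℝ) where
  carrier := {g | ∃ p : ℝ[X], ∀ x : NNReal, g x = p.eval (Real.exp (-x))}
  mul_mem' := by
    rintro f g ⟨p, hp⟩ ⟨q, hq⟩
    exact ⟨p * q, fun x => by simp [hp, hq]⟩
  add_mem' := by
    rintro f g ⟨p, hp⟩ ⟨q, hq⟩
    exact ⟨p + q, fun x => by simp [hp, hq]⟩
  algebraMap_mem' := fun r => ⟨C r, fun x => by simp⟩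
  star_mem' := by
    rintro f ⟨p, hp⟩
    exact ⟨p, fun x => by simp [hp]⟩

theorem separatesPoints_expPolynomials :
    (expPolynomials.map (toContinuousMapStarₐ ℝ)).SeparatesPoints := by
  intro x y hxy
  let e : NNReal →ᵇ ℝ := BoundedContinuousFunction.ofNormedAddCommGroup
    (fun x : NNReal => Real.exp (-x)) (by fun_prop) 1 fun x => by
      rw [Real.norm_eq_abs, abs_of_pos (Real.exp_pos _)]
      exact Real.exp_le_one_iff.2 (by simp)
  refine ⟨e, ⟨toContinuousMapStarₐ ℝ e, ⟨e, ⟨X, fun x => ?_⟩, rfl⟩, rfl⟩, fun h => hxy ?_⟩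
  · rw [eval_X]
    rfl
  · have h1 : Real.exp (-x) = Real.exp (-y) := h
    exact NNReal.eq (neg_injective (Real.exp_injective h1))

theorem integrable_exp_neg_pow (μ : Measure NNReal) [IsFiniteMeasure μ] (n : ℕ) :
    Integrable (fun x : NNReal => Real.exp (-x) ^ n) μ := by
  refine Integrable.of_bound (C := 1) (by fun_prop) (.of_forall fun x => ?_)
  rw [norm_pow, Real.norm_eq_abs, abs_of_pos (Real.exp_pos _)]
  exact pow_le_one₀ (Real.exp_pos _).le (Real.exp_le_one_iff.2 (by simp))

/-- On a Polish space a point-separating algebra of bounded continuous functions determines finite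
measures; working on [0, ∞) makes e^{-x} bounded. -/
theorem NNReal.measure_ext_of_integral_exp_neg_pow {μ ν : Measure NNReal} [IsFiniteMeasure μ]
    [IsFiniteMeasure ν]
    (h : ∀ n : ℕ, ∫ x, Real.exp (-x) ^ n ∂μ = ∫ x, Real.exp (-x) ^ n ∂ν) : μ = ν := by
  refine ext_of_forall_mem_subalgebra_integral_eq_of_polish (𝕜 := ℝ)
    separatesPoints_expPolynomials ?_
  rintro g ⟨p, hp⟩
  simp only [hp, eval_eq_sum_range]
  rw [integral_finsetSum _ fun i _ => (integrable_exp_neg_pow μ i).const_mul _,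
    integral_finsetSum _ fun i _ => (integrable_exp_neg_pow ν i).const_mul _]
  simp only [integral_const_mul, h]

theorem measure_eq_map_toNNReal {μ : Measure ℝ} (hμ : ∀ᵐ x ∂μ, 0 ≤ x) :
    (μ.map Real.toNNReal).map ((↑) : NNReal → ℝ) = μ := by
  rw [Measure.map_map (by fun_prop) (by fun_prop)]
  conv_rhs => rw [← Measure.map_id (μ := μ)]
  refine Measure.map_congr (hμ.mono fun x hx => ?_)
  simp [hx]

theorem measure_ext_of_laplace {μ ν : Measure ℝ} [IsProbabilityMeasure μ] [IsProbabilityMeasure ν]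
    (hμ : ∀ᵐ x ∂μ, 0 ≤ x) (hν : ∀ᵐ x ∂ν, 0 ≤ x)
    (h : ∀ η : ℝ, 0 < η → ∫ x, Real.exp (-(η * x)) ∂μ = ∫ x, Real.exp (-(η * x)) ∂ν) : μ = ν := by
  have : IsProbabilityMeasure (μ.map Real.toNNReal) :=
    Measure.isProbabilityMeasure_map (by fun_prop)
  have : IsProbabilityMeasure (ν.map Real.toNNReal) :=
    Measure.isProbabilityMeasure_map (by fun_prop)
  have key : ∀ {κ : Measure ℝ}, (∀ᵐ x ∂κ, 0 ≤ x) → ∀ n : ℕ,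
      ∫ x, Real.exp (-x) ^ n ∂(κ.map Real.toNNReal) = ∫ x, Real.exp (-(n * x)) ∂κ := by
    intro κ hκ n
    rw [integral_map (by fun_prop) (by fun_prop)]
    refine integral_congr_ae (hκ.mono fun x hx => ?_)
    simp only
    rw [Real.coe_toNNReal _ hx, ← Real.exp_nat_mul]
    ring_nf
  rw [← measure_eq_map_toNNReal hμ, ← measure_eq_map_toNNReal hν]
  congr 1
  refine NNReal.measure_ext_of_integral_exp_neg_pow fun n => ?_
  rw [key hμ, key hν]
  -- The hypothesis excludes η = 0; there both sides are total masses, equal to 1.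
  cases n with
  | zero => simp
  | succ n => exact h _ (by positivity)

theorem IsGenStableLaw.unique {α ρ t : ℝ} {μ ν : Measure ℝ} (hμ : IsGenStableLaw α ρ t μ)
    (hν : IsGenStableLaw α ρ t ν) : μ = ν := by
  have := hμ.isProbabilityMeasure
  have := hν.isProbabilityMeasure
  exact measure_ext_of_laplace hμ.nonneg hν.nonneg fun η hη => by
    rw [hμ.laplace η hη, hν.laplace η hη]

theorem IsGenStableProcess.isGenStableLaw_map {Ω : Type*} [MeasurableSpace Ω] {P : Measure Ω}
    {α ρ : ℝ} {X : NNReal → Ω → ℝ} (hX : IsGenStableProcess P α ρ X) {t : ℝ} (ht : 0 < t) :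
    IsGenStableLaw α ρ t (P.map (X t.toNNReal)) := by
  have := hX.isProbabilityMeasure
  have hm := hX.aemeasurable t.toNNReal
  refine ⟨Measure.isProbabilityMeasure_map hm, ?_, fun η hη => ?_⟩
  · exact (ae_map_iff hm measurableSet_Ici).2 (hX.nonneg _)
  · rw [integral_map hm (by fun_prop)]
    have h := hX.laplace 1 (fun k => if k = 0 then 0 else t.toNNReal) (fun _ => η) (by simp)
      (fun k hk => by
        obtain rfl : k = 0 := by omega
        simpa using ht)
      (fun _ _ => hη.le)
    simpa [ht.le] using h

end LaplaceUniqueness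

/-! ### Identification of the two Fox functions. -/

section FoxFunctions

open Set Complex

/-- `foxH` integrates along an arbitrarily chosen line, so it is accessible only through a value
common to all separating lines. -/
theorem foxHExists_and_foxH_eq {m n p q : ℕ} {a A : Fin p → ℝ} {b B : Fin q → ℝ} {z V : ℂ}
    (hex : ∃ c : ℝ, FoxHSeparates m n a A b B c)
    (h : ∀ c : ℝ, FoxHSeparates m n a A b B c →
      Integrable (fun y : ℝ => foxHIntegrand m n a A b B z (c + y * I)) ∧
        foxHLineIntegral m n a A b B c z = V) :
    FoxHExists m n a A b B z ∧ foxH m n a A b B z = V := by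
  have hV : foxH m n a A b B z = V := by
    rw [foxH, dif_pos hex]
    exact (h _ hex.choose_spec).2
  exact ⟨⟨hex, fun c hc => ⟨(h c hc).1, (h c hc).2.trans hV.symm⟩⟩, hV⟩

variable {α ρ : ℝ}

theorem foxH_genStable (hα₀ : 0 < α) (hα₁ : α < 1) (hρ₀ : 0 < ρ) (hρ₁ : ρ ≤ 1 / α)
    {t x : ℝ} (ht : 0 < t) (hx : 0 < x) :
    FoxHExists 0 1 ![1 - ρ] ![1] ![0] ![α] ((x ^ α / t : ℝ) : ℂ) ∧
      foxH 0 1 ![1 - ρ] ![1] ![0] ![α] ((x ^ α / t : ℝ) : ℂ) = (barnesDensity α ρ 0 t x : ℂ) := by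
  have hu : 0 < x ^ α / t := div_pos (Real.rpow_pos_of_pos hx _) ht
  refine foxHExists_and_foxH_eq ⟨0, (foxHSeparates_iff_lt α ρ 0).2 hρ₀⟩ fun c hc => ?_
  rw [foxHSeparates_iff_lt] at hc
  refine ⟨?_, ?_⟩
  · simp only [foxHIntegrand_eq_barnesRatio]
    exact integrable_barnesIntegrand hα₀ hα₁ hρ₁ hc hu
  · rw [foxHLineIntegral_eq_barnesKernel]
    exact barnesKernel_eq_barnesDensity hα₀ hα₁ hρ₁ hc hρ₀ ht hx

theorem foxHSeparates_stable_iff (hα₀ : 0 < α) (c : ℝ) :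
    FoxHSeparates 1 0 ![1] ![1] ![1 / α] ![1 / α] c ↔ -1 < c := by
  have hdiv : ∀ k : ℕ, -(1 / α + k) / (1 / α) = -1 - α * k := fun k => by
    field_simp
    ring
  simp only [FoxHSeparates, not_lt_zero, false_imp_iff, implies_true, and_true, Fin.forall_fin_one,
    Matrix.cons_val_fin_one, hdiv]
  constructor
  · intro h
    simpa using h (by simp) 0
  · intro h _ k
    have : 0 ≤ α * k := by positivity
    linarith

/-- The substitution `s ↦ -(1 + s) / α` carries one Mellin–Barnes integrand to the other. -/
theorem foxHIntegrand_stable_eq (hα₀ : 0 < α) {t x c : ℝ} (ht : 0 < t) (hx : 0 < x) (hc : -1 < c)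
    (y : ℝ) :
    foxHIntegrand 1 0 ![1] ![1] ![1 / α] ![1 / α] ((t ^ (1 / α) / x : ℝ) : ℂ) (c + y * I) =
      (α * (t ^ (1 / α) / x) : ℝ) * (barnesRatio α 1 ((-(1 + c) / α : ℝ) + (-α⁻¹ * y : ℝ) * I) *
        ((x ^ α / t : ℝ) : ℂ) ^ (-((-(1 + c) / α : ℝ) + (-α⁻¹ * y : ℝ) * I : ℂ))) := by
  have hαC : (α : ℂ) ≠ 0 := by exact_mod_cast hα₀.ne'
  have hz : 0 < t ^ (1 / α) / x := div_pos (Real.rpow_pos_of_pos ht _) hx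
  have hu : 0 < x ^ α / t := div_pos (Real.rpow_pos_of_pos hx _) ht
  set s : ℂ := c + y * I with hs
  have hs1 : 1 + s ≠ 0 := fun h0 => by
    have := congrArg Complex.re h0
    simp [hs] at this
    linarith
  have hs0 : ((-(1 + c) / α : ℝ) + (-α⁻¹ * y : ℝ) * I : ℂ) = -((1 + s) / α) := by
    rw [hs]
    push_cast
    field_simp
    ring
  have hlogz : Real.log (t ^ (1 / α) / x) = α⁻¹ * Real.log t - Real.log x := by
    rw [Real.log_div (Real.rpow_pos_of_pos ht _).ne' hx.ne', Real.log_rpow ht, one_div]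
  have hlogu : Real.log (x ^ α / t) = α * Real.log x - Real.log t := by
    rw [Real.log_div (Real.rpow_pos_of_pos hx _).ne' ht.ne', Real.log_rpow hx]
  have hzexp : ((α * (t ^ (1 / α) / x) : ℝ) : ℂ) =
      α * exp (α⁻¹ * Real.log t - Real.log x : ℝ) := by
    rw [← hlogz, ← ofReal_exp, Real.exp_log hz]
    push_cast
    rfl
  -- The factors 1 + s here and in `hΓ2` cancel in the quotient and leave 1/α, which the prefactor α
  -- compensates.
  have hΓ1 : Gamma (1 - -((1 + s) / α)) = (1 + s) / α * Gamma ((1 + s) / α) := by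
    rw [← Gamma_add_one _ (div_ne_zero hs1 hαC)]
    congr 1
    ring
  have hΓ2 : Gamma (1 - α * -((1 + s) / α)) = (1 + s) * Gamma (1 + s) := by
    rw [← Gamma_add_one _ hs1]
    congr 1
    field_simp
    ring
  have hL : foxHIntegrand 1 0 ![1] ![1] ![1 / α] ![1 / α] ((t ^ (1 / α) / x : ℝ) : ℂ) s =
      Gamma ((1 + s) / α) * ((t ^ (1 / α) / x : ℝ) : ℂ) ^ (-s) / Gamma (1 + s) := by
    simp [foxHIntegrand]
    ring_nf
  rw [hL, hs0, barnesRatio, ofReal_one, hΓ1, hΓ2, ofReal_cpow_eq_exp hz, ofReal_cpow_eq_exp hu,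
    hlogz, hlogu, hzexp]
  have hexp : exp ((α⁻¹ * Real.log t - Real.log x : ℝ) * -s) =
      exp (α⁻¹ * Real.log t - Real.log x : ℝ) *
        exp ((α * Real.log x - Real.log t : ℝ) * - -((1 + s) / α)) := by
    rw [← exp_add]
    congr 1
    push_cast
    field_simp
    ring
  rw [hexp]
  field_simp

theorem foxH_stable (hα₀ : 0 < α) (hα₁ : α < 1) {t x : ℝ} (ht : 0 < t) (hx : 0 < x) :
    FoxHExists 1 0 ![1] ![1] ![1 / α] ![1 / α] ((t ^ (1 / α) / x : ℝ) : ℂ) ∧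
      foxH 1 0 ![1] ![1] ![1 / α] ![1 / α] ((t ^ (1 / α) / x : ℝ) : ℂ) =
        ((α ^ 2 * (t ^ (1 / α) / x) * barnesDensity α 1 0 t x : ℝ) : ℂ) := by
  have hu : 0 < x ^ α / t := div_pos (Real.rpow_pos_of_pos hx _) ht
  have hρ₁ : 1 ≤ 1 / α := (one_le_div hα₀).2 hα₁.le
  refine foxHExists_and_foxH_eq ⟨0, (foxHSeparates_stable_iff hα₀ 0).2 (by norm_num)⟩ fun c hc => ?_
  rw [foxHSeparates_stable_iff hα₀] at hc
  -- The substitution maps lines right of -1 to lines left of 0, which are separating for the other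
  -- kernel with ρ = 1.
  have hc' : -(1 + c) / α < 1 :=
    (div_neg_of_neg_of_pos (by linarith) hα₀).trans one_pos
  have hint := integrable_barnesIntegrand hα₀ hα₁ hρ₁ hc' hu
  have hne : -α⁻¹ ≠ 0 := neg_ne_zero.2 (inv_ne_zero hα₀.ne')
  refine ⟨?_, ?_⟩
  · simp only [foxHIntegrand_stable_eq hα₀ ht hx hc]
    exact (hint.comp_mul_left' hne).const_mul _
  · simp only [foxHLineIntegral, foxHIntegrand_stable_eq hα₀ ht hx hc]
    -- The Jacobian of y ↦ -y/α supplies the second factor α in α².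
    rw [integral_mul_const, integral_const_mul, Measure.integral_comp_mul_left (fun y : ℝ =>
      barnesRatio α 1 ((-(1 + c) / α : ℝ) + y * I) *
        ((x ^ α / t : ℝ) : ℂ) ^ (-((-(1 + c) / α : ℝ) + y * I : ℂ)))]
    have hK := barnesKernel_eq_barnesDensity hα₀ hα₁ hρ₁ hc' one_pos ht hx
    rw [ofReal_mul (α ^ 2 * (t ^ (1 / α) / x)), ← hK, barnesKernel, inv_neg, inv_inv, abs_neg, abs_of_pos hα₀, real_smul]
    push_cast
    field_simp

theorem upperIncompleteGamma_one (y : ℝ) : upperIncompleteGamma 1 y = Real.exp (-y) := by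
  simp [upperIncompleteGamma, integral_exp_Iic]

end FoxFunctions

theorem theorem3p4 (α ρ : ℝ) (hα₀ : 0 < α) (hα₁ : α < 1) (hρ₀ : 0 < ρ) (hρ₁ : ρ ≤ 1 / α) :
    ∃ h : ℝ → ℝ → ℝ, ∀ t : ℝ, 0 < t →
      -- the formula, with a well-defined Fox function
      (∀ x : ℝ, 0 < x →
        FoxHExists 0 1 ![1 - ρ] ![1] ![0] ![α] ((x ^ α / t : ℝ) : ℂ) ∧
        (h x t : ℂ) = ((α / (x * Real.Gamma ρ) : ℝ) : ℂ) *
          foxH 0 1 ![1 - ρ] ![1] ![0] ![α] ((x ^ α / t : ℝ) : ℂ)) ∧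
      -- it is a non-negative measurable function, carried by the positive half-line
      (∀ x : ℝ, x ≤ 0 → h x t = 0) ∧
      (∀ x : ℝ, 0 ≤ h x t) ∧
      Measurable (fun x => h x t) ∧
      -- the measure with this density is a law with the prescribed Laplace transform
      IsGenStableLaw α ρ t (volume.withDensity fun x => ENNReal.ofReal (h x t)) ∧
      -- and the only one
      (∀ μ : Measure ℝ, IsGenStableLaw α ρ t μ →
        μ = volume.withDensity fun x => ENNReal.ofReal (h x t)) ∧
      -- it is the density at time `t` of every process with the prescribed Laplace transforms
      (∀ {Ω : Type*} [MeasurableSpace Ω] (P : Measure Ω) (X : NNReal → Ω → ℝ),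
        IsGenStableProcess P α ρ X →
        P.map (X t.toNNReal) = volume.withDensity fun x => ENNReal.ofReal (h x t)) ∧
      -- for `ρ = 1` it is the density of the stable law
      (ρ = 1 →
        (∀ η : ℝ, 0 < η →
          ∫ x, Real.exp (-(η * x)) ∂(volume.withDensity fun x => ENNReal.ofReal (h x t)) =
            Real.exp (-(η ^ α * t))) ∧
        ∀ x : ℝ, 0 < x →
          FoxHExists 1 0 ![1] ![1] ![1 / α] ![1 / α] ((t ^ (1 / α) / x : ℝ) : ℂ) ∧
          (h x t : ℂ) = ((1 / (t ^ (1 / α) * α) : ℝ) : ℂ) *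
            foxH 1 0 ![1] ![1] ![1 / α] ![1 / α] ((t ^ (1 / α) / x : ℝ) : ℂ)) := by
  refine ⟨genStableDensity α ρ, fun t ht => ?_⟩
  have hlaw := isGenStableLaw_genStableDensity hα₀ hα₁ hρ₀ hρ₁ ht
  refine ⟨fun x hx => ?_, fun x hx => genStableDensity_of_nonpos hx,
    genStableDensity_nonneg hα₀ hα₁ hρ₀ hρ₁ ht, measurable_genStableDensity hα₀ hα₁ hρ₀ hρ₁ ht,
    hlaw, fun μ hμ => hμ.unique hlaw, fun P X hX => (hX.isGenStableLaw_map ht).unique hlaw, ?_⟩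
  · obtain ⟨hE, hV⟩ := foxH_genStable hα₀ hα₁ hρ₀ hρ₁ ht hx
    refine ⟨hE, ?_⟩
    rw [hV, genStableDensity_of_pos hx]
    push_cast
    rfl
  · rintro rfl
    refine ⟨fun η hη => ?_, fun x hx => ?_⟩
    · rw [hlaw.laplace η hη, upperIncompleteGamma_one, Real.Gamma_one, div_one]
    · obtain ⟨hE, hV⟩ := foxH_stable hα₀ hα₁ ht hx
      refine ⟨hE, ?_⟩
      have hT : t ^ (1 / α) ≠ 0 := (Real.rpow_pos_of_pos ht _).ne'
      rw [hV, genStableDensity_of_pos hx, Real.Gamma_one, ← Complex.ofReal_mul]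
      congr 1
      field_simp
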